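/- Let $n\ge 0$ and let $\pi:\mathbb{R}^n\to(\mathbb{R}/\mathbb{Z})^n$ be the quotient map. A $k$-dimensional subtorus of $(\mathbb{R}/\mathbb{Z})^n$ is a subgroup $\pi(W)$, where $W\subseteq\mathbb{R}^n$ is a $k$-dimensional real subspace spanned by vectors of $\mathbb{Z}^n$. A closed subgroup of $(\mathbb{R}/\mathbb{Z})^n$ has dimension $k$ if it is the internal direct product of a $k$-dimensional subtorus and a finite subgroup. A subset $X\subseteq(\mathbb{R}/\mathbb{Z})^n$ is proper if it is not contained in the union of the coordinate hyperplanes $\{x_i=0\}$, and $D(X)$ denotes the $L^\infty$-distance from $X$ to the point $(1/2,\dots,1/2)$. Let $\mathcal{S}_k(n)$ (for $1\le k\le n$) be the set of all values $D(T)$, where $T$ ranges over the $k$-dimensional proper subtori of $(\mathbb{R}/\mathbb{Z})^n$, and let $\mathcal{S}^*_k(n)$ (for $0\le k\le n$) be the set of all values $D(\Delta)$, where $\Delta$ ranges over the $k$-dimensional proper closed subgroups of $(\mathbb{R}/\mathbb{Z})^n$; in particular $\mathcal{S}^*_0(0)=\{0\}$. Let $\mathcal{S}_{k,\mathrm{mult}}(n)$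 and $\mathcal{S}^*_{k,\mathrm{mult}}(n)$ be the corresponding multisets, in which the multiplicity of $d$ is the (possibly infinite) number of such $T$, respectively $\Delta$, with $D$-value $d$. Write $\mathcal{S}(n)=\mathcal{S}_1(n)$ and $\mathcal{S}^*(n)=\mathcal{S}^*_1(n)$. For $A\subseteq\mathbb{R}$ let $\mathrm{acc}(A)$ be the set of accumulation points of $A$. A point $x$ is an upper (respectively lower) accumulation point of $A$ if $A\cap(x,x+\varepsilon)\ne\emptyset$ (respectively $A\cap(x-\varepsilon,x)\neq\emptyset$) for all $\varepsilon>0$. For a multiset $M$ of real numbers, $\mathrm{den}(M)$ is the set consisting of the accumulation points of the underlying set of $M$ and of the elements of $M$ of infinite multiplicity. **Theorem.** Let $n\ge 2$, $1\le k<n$ and $0\le k'<n$ be integers. Then every accumulation point of $\mathcal{S}_k(n)$, and every accumulation point of $\mathcal{S}^*_{k'}(n)$, is an upper accumulation point and not a lower accumulation point of that set. Moreover, $$\mathrm{acc}(\mathcal{S}_k(n))\subseteq\mathcal{S}_{k+1}(n)\subseteq\mathcal{S}^*_{k+1}(n)=\mathcal{S}^*_0(n-k-1),$$ $$\mathrm{den}(\mathcal{S}_{k,\mathrm{mult}}(n))=\mathcal{S}_{k+1}(n),\qquad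 \mathrm{den}(\mathcal{S}^*_{k',\mathrm{mult}}(n))=\mathcal{S}^*_{k'+1}(n)=\mathcal{S}^*_{k'}(n-1),$$ and $$\mathcal{S}(n-1)\subseteq\mathrm{acc}(\mathcal{S}(n))\subseteq\mathcal{S}_2(n)\subseteq\mathcal{S}^*_2(n)=\mathcal{S}^*(n-1).$$ -/

import Mathlib

noncomputable section

namespace LonelyRunner

/-- The torus `(ℝ/ℤ)^n`. Its metric is the `L^∞` metric: the supremum over the coordinates of the
distance in `ℝ/ℤ`. -/
abbrev Torus (n : ℕ) : Type := Fin n → UnitAddCircle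

/-- The standard quotient map `π : ℝ^n → (ℝ/ℤ)^n`. -/
def proj (n : ℕ) : (Fin n → ℝ) →+ Torus n :=
  (QuotientAddGroup.mk' (AddSubgroup.zmultiples (1 : ℝ))).compLeft (Fin n)

/-- The standard lattice `ℤ^n ⊆ ℝ^n`. -/
def intVectors (n : ℕ) : Set (Fin n → ℝ) :=
  {v | ∀ i, ∃ z : ℤ, v i = (z : ℝ)}

/-- A real subspace of `ℝ^n` is rational if it is spanned by its integer vectors. -/
def IsRational {n : ℕ} (W : Submodule ℝ (Fin n → ℝ)) : Prop :=
  Submodule.span ℝ ((W : Set (Fin n → ℝ)) ∩ intVectors n) = W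

/-- `T` is a `k`-dimensional (closed) subtorus of `(ℝ/ℤ)^n`: the image under `π` of a
`k`-dimensional rational subspace of `ℝ^n`. -/
def IsSubtorus {n : ℕ} (k : ℕ) (T : AddSubgroup (Torus n)) : Prop :=
  ∃ W : Submodule ℝ (Fin n → ℝ),
    IsRational W ∧ Module.finrank ℝ W = k ∧ T = W.toAddSubgroup.map (proj n)

/-- `Δ` is a closed subgroup of `(ℝ/ℤ)^n` of dimension `k`: it is closed, and it is the (internal)
direct product of a `k`-dimensional subtorus and a finite subgroup. -/
def IsSubgroupOfDim {n : ℕ} (k : ℕ) (Δ : AddSubgroup (Torus n)) : Prop :=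
  IsClosed (Δ : Set (Torus n)) ∧
    ∃ T H : AddSubgroup (Torus n),
      IsSubtorus k T ∧ (H : Set (Torus n)).Finite ∧ T ⊓ H = ⊥ ∧ T ⊔ H = Δ

/-- `X` is proper if it is not contained in the union of the coordinate hyperplanes. -/
def IsProper {n : ℕ} (X : Set (Torus n)) : Prop :=
  ¬ X ⊆ ⋃ i : Fin n, {x | x i = 0}

/-- The point `(1/2, …, 1/2)` of the torus. -/
def center (n : ℕ) : Torus n := proj n (fun _ => 1 / 2)

/-- `D(X)`: the `L^∞` distance from `X` to the point `(1/2, …, 1/2)`. -/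
def D {n : ℕ} (X : Set (Torus n)) : ℝ := Metric.infDist (center n) X

/-- The `k`-dimensional proper subtori of `(ℝ/ℤ)^n`. -/
def properSubtori (k n : ℕ) : Set (AddSubgroup (Torus n)) :=
  {T | IsSubtorus k T ∧ IsProper (T : Set (Torus n))}

/-- The `k`-dimensional proper (closed) subgroups of `(ℝ/ℤ)^n`. -/
def properSubgroups (k n : ℕ) : Set (AddSubgroup (Torus n)) :=
  {Δ | IsSubgroupOfDim k Δ ∧ IsProper (Δ : Set (Torus n))}

/-- The spectrum `S_k(n)`. -/
def S (k n : ℕ) : Set ℝ :=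
  {d | ∃ T ∈ properSubtori k n, D (T : Set (Torus n)) = d}

/-- The subgroup spectrum `S*_k(n)`. -/
def SStar (k n : ℕ) : Set ℝ :=
  {d | ∃ Δ ∈ properSubgroups k n, D (Δ : Set (Torus n)) = d}

/-- The multiset spectrum `S_{k,mult}(n)`, as a multiplicity function with values in `ℕ∞`. -/
def SMult (k n : ℕ) : ℝ → ℕ∞ := fun d =>
  Set.encard {T | T ∈ properSubtori k n ∧ D (T : Set (Torus n)) = d}

/-- The multiset spectrum `S*_{k,mult}(n)`, as a multiplicity function with values in `ℕ∞`. -/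
def SStarMult (k n : ℕ) : ℝ → ℕ∞ := fun d =>
  Set.encard {Δ | Δ ∈ properSubgroups k n ∧ D (Δ : Set (Torus n)) = d}

/-- The set of accumulation points of a set of real numbers. -/
def acc (A : Set ℝ) : Set ℝ := {x | AccPt x (Filter.principal A)}

/-- `x` is an upper accumulation point of `A`. -/
def IsUpperAcc (A : Set ℝ) (x : ℝ) : Prop :=
  ∀ ε : ℝ, 0 < ε → (A ∩ Set.Ioo x (x + ε)).Nonempty

/-- `x` is a lower accumulation point of `A`. -/
def IsLowerAcc (A : Set ℝ) (x : ℝ) : Prop :=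
  ∀ ε : ℝ, 0 < ε → (A ∩ Set.Ioo (x - ε) x).Nonempty

/-- All accumulation points of `A` are accumulation points from above and not from below. -/
def HasOnlyUpperAcc (A : Set ℝ) : Prop :=
  ∀ x ∈ acc A, IsUpperAcc A x ∧ ¬ IsLowerAcc A x

/-- The density points of a multiset `m` of real numbers: the accumulation points of the set of
its elements, together with its elements of infinite multiplicity. -/
def den (m : ℝ → ℕ∞) : Set ℝ :=
  acc {x | m x ≠ 0} ∪ {x | m x = ⊤}

end LonelyRunner

end

noncomputable section

namespace LonelyRunner

open Filter Topology

/-! ### Integer vectors, linear forms and characters -/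

/-! A closed subgroup `Δ` is handled through its tangent space: the rational subspace `W` whose
torus has finite index in `Δ`. Three mechanisms then give the theorem.

Compactness. Along an ultrafilter, any family of subgroups has a limit `Δ'`, cut out by the
characters that are eventually trivial on the family. Eventually the members lie in `Δ'`, and every
point of `Δ'` is approximated by points of the members (`exists_limit`). So the values of `D`
converge to `D Δ'` and eventually are at least `D Δ'`, which excludes accumulation from below. Only
finitely many subgroups lie between the torus of `W` and `Δ'`, so a nonprincipal limit of
`k`-dimensional subgroups has dimension greater than `k`. A limit of subtori is a subtorus.

Cutting. If `dim Δ > 0`, a nearest point to the center can be chosen extreme, and then two of its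
active coordinates satisfy `s x_i = t x_j` with signs `s`, `t`. Imposing this equation keeps `D`,
lowers the dimension by one and makes the coordinate `j` redundant (`IsTangent.exists_cut`).
Deleting that coordinate, and conversely adding a free one, identifies `SStar (k + 1) (m + 1)` with
`SStar k m`. Repeated cutting also yields a torsion nearest point, through which a subtorus of
dimension at least 2 can be sliced without losing connectedness. The spectra are therefore
decreasing in the dimension, which absorbs limits of too large a dimension.

Approximation. Cutting `Δ` by characters with growing coefficients gives infinitely many subgroups
of one dimension less that fill `Δ` ever more densely, so `D Δ` is a density point. For true
accumulation of `S 1`, a coordinate of large speed is added to a line. If the speed is divisible by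
a suitable factorial, the new coordinate vanishes at every optimal time of the old line, so `D`
strictly increases (`S_one_subset_acc`). -/

/-- The linear form on `ℝ^n` with integer coefficients `a`. -/
def dot {n : ℕ} (a : Fin n → ℤ) : (Fin n → ℝ) →ₗ[ℝ] ℝ :=
  ∑ i, (a i : ℝ) • LinearMap.proj i

/-- The character of the torus with integer coefficients `a`. -/
def chr {n : ℕ} (a : Fin n → ℤ) : Torus n →+ UnitAddCircle :=
  ∑ i, a i • Pi.evalAddMonoidHom (fun _ : Fin n => UnitAddCircle) i

/-- The real vector underlying an integer vector. -/
def toReal {n : ℕ} (z : Fin n → ℤ) : Fin n → ℝ := fun i => (z i : ℝ)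

/-- The image in the torus of a real subspace. -/
abbrev torusOf {n : ℕ} (W : Submodule ℝ (Fin n → ℝ)) : AddSubgroup (Torus n) :=
  W.toAddSubgroup.map (proj n)

variable {n : ℕ}

lemma dot_apply (a : Fin n → ℤ) (w : Fin n → ℝ) : dot a w = ∑ i, (a i : ℝ) * w i := by
  simp [dot]

lemma chr_apply (a : Fin n → ℤ) (x : Torus n) : chr a x = ∑ i, a i • x i := by
  simp [chr]

@[simp] lemma proj_apply (w : Fin n → ℝ) (i : Fin n) : proj n w i = (w i : UnitAddCircle) := rfl

lemma chr_proj (a : Fin n → ℤ) (w : Fin n → ℝ) :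
    chr a (proj n w) = ((dot a w : ℝ) : UnitAddCircle) := by
  rw [chr_apply, dot_apply]
  have h := map_sum (QuotientAddGroup.mk' (AddSubgroup.zmultiples (1 : ℝ)))
    (fun i => (a i : ℝ) * w i) Finset.univ
  refine Eq.trans ?_ h.symm
  refine Finset.sum_congr rfl fun i _ => ?_
  rw [← zsmul_eq_mul, map_zsmul]
  rfl

lemma chr_add (a b : Fin n → ℤ) (x : Torus n) : chr (a + b) x = chr a x + chr b x := by
  simp [chr_apply, add_smul, Finset.sum_add_distrib]

lemma chr_neg (a : Fin n → ℤ) (x : Torus n) : chr (-a) x = -chr a x := by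
  simp [chr_apply]

lemma chr_zero (x : Torus n) : chr (0 : Fin n → ℤ) x = 0 := by
  simp [chr_apply]

lemma continuous_chr (a : Fin n → ℤ) : Continuous (chr a) := by
  have : (chr a : Torus n → UnitAddCircle) = fun x => ∑ i, a i • x i := by
    ext x; exact chr_apply a x
  rw [this]
  fun_prop

lemma toReal_mem (z : Fin n → ℤ) : toReal z ∈ intVectors n := fun i => ⟨z i, rfl⟩

lemma exists_eq_toReal {v : Fin n → ℝ} (hv : v ∈ intVectors n) : ∃ z, v = toReal z := by
  choose z hz using hv
  exact ⟨z, funext hz⟩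

lemma proj_eq_zero_iff {v : Fin n → ℝ} : proj n v = 0 ↔ v ∈ intVectors n := by
  constructor
  · intro h i
    have hi := congrFun h i
    rw [proj_apply, Pi.zero_apply, AddCircle.coe_eq_zero_iff] at hi
    obtain ⟨z, hz⟩ := hi
    exact ⟨z, by simpa using hz.symm⟩
  · intro h
    ext i
    obtain ⟨z, hz⟩ := h i
    rw [proj_apply, Pi.zero_apply, AddCircle.coe_eq_zero_iff, hz]
    exact ⟨z, by simp⟩

@[simp] lemma proj_toReal (z : Fin n → ℤ) : proj n (toReal z) = 0 :=
  proj_eq_zero_iff.2 (toReal_mem z)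

lemma proj_surjective : Function.Surjective (proj n) := by
  intro x
  have : ∀ i, ∃ t : ℝ, (t : UnitAddCircle) = x i := fun i => QuotientAddGroup.mk_surjective (x i)
  choose y hy using this
  exact ⟨y, funext hy⟩

lemma continuous_proj : Continuous (proj n) :=
  continuous_pi fun i => (AddCircle.continuous_mk' 1).comp (continuous_apply i)

lemma IsRational.exists_int {W : Submodule ℝ (Fin n → ℝ)} (hW : IsRational W)
    (f : (Fin n → ℝ) →ₗ[ℝ] ℝ) (hf : ∃ w ∈ W, f w ≠ 0) :
    ∃ z : Fin n → ℤ, toReal z ∈ W ∧ f (toReal z) ≠ 0 := by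
  by_contra! h
  obtain ⟨w, hw, hfw⟩ := hf
  have : W ≤ LinearMap.ker f := by
    rw [← hW, Submodule.span_le]
    rintro v ⟨hv, hv'⟩
    obtain ⟨z, rfl⟩ := exists_eq_toReal hv'
    exact h z hv
  exact hfw (this hw)

lemma isRational_of_le_span {W : Submodule ℝ (Fin n → ℝ)}
    (h : W ≤ Submodule.span ℝ ((W : Set (Fin n → ℝ)) ∩ intVectors n)) : IsRational W :=
  le_antisymm (Submodule.span_le.2 Set.inter_subset_left) h

lemma isRational_span {s : Set (Fin n → ℝ)} (hs : s ⊆ intVectors n) :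
    IsRational (Submodule.span ℝ s) :=
  isRational_of_le_span (Submodule.span_mono fun _ hv => ⟨Submodule.subset_span hv, hs hv⟩)

lemma isRational_top : IsRational (⊤ : Submodule ℝ (Fin n → ℝ)) := by
  have : (⊤ : Submodule ℝ (Fin n → ℝ)) = Submodule.span ℝ (Set.range (Pi.basisFun ℝ (Fin n))) :=
    (Module.Basis.span_eq _).symm
  rw [this]
  refine isRational_span ?_
  rintro _ ⟨i, rfl⟩ j
  by_cases h : j = i
  · subst h; exact ⟨1, by simp⟩
  · exact ⟨0, by simp [h]⟩

lemma dot_toReal (a z : Fin n → ℤ) : dot a (toReal z) = ((∑ i, a i * z i : ℤ) : ℝ) := by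
  simp [dot_apply, toReal]

lemma smul_mem_intVectors {v : Fin n → ℝ} (hv : v ∈ intVectors n) (m : ℤ) :
    (m : ℝ) • v ∈ intVectors n := fun i => by
  obtain ⟨z, hz⟩ := hv i
  exact ⟨m * z, by simp [hz]⟩

lemma sub_mem_intVectors {v w : Fin n → ℝ} (hv : v ∈ intVectors n) (hw : w ∈ intVectors n) :
    v - w ∈ intVectors n := fun i => by
  obtain ⟨z, hz⟩ := hv i
  obtain ⟨y, hy⟩ := hw i
  exact ⟨z - y, by simp [hz, hy]⟩

/-- The part of a subspace on which an integral linear form vanishes. -/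
abbrev slice (W : Submodule ℝ (Fin n → ℝ)) (a : Fin n → ℤ) : Submodule ℝ (Fin n → ℝ) :=
  W ⊓ LinearMap.ker (dot a)

/-- With `z` an integer vector of `W` off the kernel, the map `P v = a(z) v - a(v) z` sends integer
vectors of `W` to integer vectors of the slice, and on the slice it is multiplication by the nonzero
scalar `a(z)`. -/
lemma IsRational.slice {W : Submodule ℝ (Fin n → ℝ)} (hW : IsRational W) (a : Fin n → ℤ) :
    IsRational (slice W a) := by
  by_cases h : ∃ w ∈ W, dot a w ≠ 0
  · obtain ⟨z, hz, haz⟩ := hW.exists_int _ h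
    refine isRational_of_le_span ?_
    set J := Submodule.span ℝ ((LonelyRunner.slice W a : Set (Fin n → ℝ)) ∩ intVectors n) with hJ
    let P : (Fin n → ℝ) →ₗ[ℝ] (Fin n → ℝ) :=
      dot a (toReal z) • LinearMap.id - (dot a).smulRight (toReal z)
    have hP : ∀ v, P v = dot a (toReal z) • v - dot a v • toReal z := fun v => by simp [P]
    have hPW : W ≤ J.comap P := by
      rw [← hW, Submodule.span_le]
      rintro v ⟨hv, hv'⟩
      refine Submodule.subset_span ⟨⟨?_, ?_⟩, ?_⟩
      · rw [hP]; exact W.sub_mem (W.smul_mem _ hv) (W.smul_mem _ hz)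
      · simp [hP, mul_comm]
      · obtain ⟨y, rfl⟩ := exists_eq_toReal hv'
        rw [hP, dot_toReal, dot_toReal]
        exact sub_mem_intVectors (smul_mem_intVectors (toReal_mem _) _)
          (smul_mem_intVectors (toReal_mem _) _)
    rintro w ⟨hw, hw'⟩
    have h1 := hPW hw
    rw [Submodule.mem_comap, hP, LinearMap.mem_ker.1 hw', zero_smul, sub_zero] at h1
    exact (J.smul_mem_iff haz).1 h1
  · push Not at h
    have : LonelyRunner.slice W a = W := inf_eq_left.2 fun w hw => h w hw
    rw [this]; exact hW

lemma finrank_slice {W : Submodule ℝ (Fin n → ℝ)} {a : Fin n → ℤ} (h : ∃ w ∈ W, dot a w ≠ 0) :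
    Module.finrank ℝ (slice W a) + 1 = Module.finrank ℝ W := by
  let f : W →ₗ[ℝ] ℝ := (dot a).comp W.subtype
  have hf : f ≠ 0 := by
    obtain ⟨w, hw, hne⟩ := h
    intro h0
    exact hne (LinearMap.congr_fun h0 ⟨w, hw⟩)
  have hr := Module.Dual.finrank_ker_add_one_of_ne_zero hf
  have : (LinearMap.ker f).map W.subtype = slice W a := by
    ext w
    simp [f, Submodule.mem_map, slice, and_comm]
  rw [← this, Submodule.finrank_map_subtype_eq, hr]

/-! ### Closed subgroups and their tangent spaces -/

/-- `W` is a rational subspace whose torus is a finite index subgroup of `Δ`. -/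
structure IsTangent (W : Submodule ℝ (Fin n → ℝ)) (Δ : AddSubgroup (Torus n)) : Prop where
  isRational : IsRational W
  le : torusOf W ≤ Δ
  relIndex_ne_zero : (torusOf W).relIndex Δ ≠ 0

lemma isTangent_torusOf {W : Submodule ℝ (Fin n → ℝ)} (hW : IsRational W) :
    IsTangent W (torusOf W) :=
  ⟨hW, le_rfl, by simp⟩

lemma torusOf_top : torusOf (⊤ : Submodule ℝ (Fin n → ℝ)) = ⊤ := by
  refine eq_top_iff.2 fun x _ => ?_
  obtain ⟨y, rfl⟩ := proj_surjective x
  exact ⟨y, trivial, rfl⟩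

/-- The kernel of a character on the torus of `W` may be disconnected. A point of it lifts to `w`
with `a(w)` an integer `j`, and subtracting `j z / a(z)` lands in the slice. So the components are
represented by multiples of the torsion point `g`, and the index stays finite. -/
lemma IsTangent.inf_ker {W : Submodule ℝ (Fin n → ℝ)} {Δ : AddSubgroup (Torus n)}
    (h : IsTangent W Δ) (a : Fin n → ℤ) : IsTangent (slice W a) (Δ ⊓ (chr a).ker) := by
  have hle : torusOf (slice W a) ≤ torusOf W ⊓ (chr a).ker := by
    rintro _ ⟨w, ⟨hw, hw'⟩, rfl⟩
    refine ⟨⟨w, hw, rfl⟩, ?_⟩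
    change chr a (proj n w) = 0
    rw [chr_proj, LinearMap.mem_ker.1 hw', AddCircle.coe_zero]
  refine ⟨h.isRational.slice a, hle.trans (inf_le_inf_right _ h.le), ?_⟩
  have h2 : (torusOf W ⊓ (chr a).ker).relIndex (Δ ⊓ (chr a).ker) ≠ 0 :=
    AddSubgroup.relIndex_inter_ne_zero h.relIndex_ne_zero _
  refine AddSubgroup.relIndex_ne_zero_trans ?_ h2
  by_cases ha : ∃ w ∈ W, dot a w ≠ 0
  · obtain ⟨z, hz, haz⟩ := h.isRational.exists_int _ ha
    set g : Torus n := proj n ((dot a (toReal z))⁻¹ • toReal z) with hg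
    have hcover : torusOf W ⊓ (chr a).ker ≤ torusOf (slice W a) ⊔ AddSubgroup.zmultiples g := by
      rintro _ ⟨⟨w, hw, rfl⟩, hw'⟩
      have hw'' : chr a (proj n w) = 0 := hw'
      rw [chr_proj, AddCircle.coe_eq_zero_iff] at hw''
      obtain ⟨j, hj⟩ := hw''
      have hj' : dot a w = j := by simpa using hj.symm
      have e : w = (w - (j : ℝ) • (dot a (toReal z))⁻¹ • toReal z)
          + (j : ℝ) • (dot a (toReal z))⁻¹ • toReal z := by abel
      rw [e, map_add]
      refine AddSubgroup.add_mem_sup ⟨_, ⟨?_, ?_⟩, rfl⟩ ⟨j, ?_⟩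
      · exact W.sub_mem hw (W.smul_mem _ (W.smul_mem _ hz))
      · simp [hj', haz]
      · simp only [hg, ← map_zsmul, Int.cast_smul_eq_zsmul]
    have hfin : (AddSubgroup.zmultiples g : Set (Torus n)).Finite := by
      have : IsOfFinAddOrder g := by
        obtain ⟨N, hN⟩ : ∃ N : ℤ, dot a (toReal z) = N := ⟨_, dot_toReal a z⟩
        rw [isOfFinAddOrder_iff_zsmul_eq_zero]
        refine ⟨N, by rintro rfl; simp [hN] at haz, ?_⟩
        rw [hg, ← map_zsmul, ← Int.cast_smul_eq_zsmul ℝ, hN, smul_inv_smul₀ (by rwa [← hN])]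
        simp
      exact this.finite_zmultiples
    intro h0
    have h1 := AddSubgroup.relIndex_eq_zero_of_le_right hcover h0
    rw [AddSubgroup.relIndex_sup_left] at h1
    have : Finite (AddSubgroup.zmultiples g) := hfin
    have h3 := AddSubgroup.relIndex_dvd_card (torusOf (slice W a)) (AddSubgroup.zmultiples g)
    rw [h1, zero_dvd_iff] at h3
    exact Nat.card_pos.ne' h3
  · push Not at ha
    have : slice W a = W := inf_eq_left.2 fun w hw => ha w hw
    intro h0
    rw [this] at h0
    rw [AddSubgroup.relIndex_eq_one.2 inf_le_left] at h0
    exact one_ne_zero h0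

/-- Coefficients over a finite spanning set of integer vectors matter only modulo 1, so the torus is
a continuous image of a cube. -/
lemma isCompact_torusOf {W : Submodule ℝ (Fin n → ℝ)} (hW : IsRational W) :
    IsCompact (torusOf W : Set (Torus n)) := by
  obtain ⟨s, hs, hspan⟩ : ∃ s : Finset (Fin n → ℝ),
      (s : Set (Fin n → ℝ)) ⊆ (W : Set (Fin n → ℝ)) ∩ intVectors n ∧
        Submodule.span ℝ (s : Set (Fin n → ℝ)) = W := by
    have hfg : (Submodule.span ℝ ((W : Set (Fin n → ℝ)) ∩ intVectors n)).FG :=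
      IsNoetherian.noetherian _
    obtain ⟨s, hs, h⟩ := (Submodule.fg_span_iff_fg_span_finset_subset _).1 hfg
    exact ⟨s, hs, by rw [← h, hW]⟩
  let F : (s → ℝ) → Torus n := fun c => proj n (∑ v, c v • (v : Fin n → ℝ))
  have hF : Continuous F := continuous_proj.comp (by fun_prop)
  have hK : IsCompact (Set.pi Set.univ fun _ : s => Set.Icc (0 : ℝ) 1) :=
    isCompact_univ_pi fun _ => isCompact_Icc
  convert hK.image hF using 1
  ext x
  constructor
  · rintro ⟨w, hw, rfl⟩
    have hw' : w ∈ Submodule.span ℝ (s : Set (Fin n → ℝ)) := by rw [hspan]; exact hw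
    rw [Submodule.mem_span_finset'] at hw'
    obtain ⟨c, rfl⟩ := hw'
    refine ⟨fun v => Int.fract (c v), fun v _ => ⟨Int.fract_nonneg _, (Int.fract_lt_one _).le⟩, ?_⟩
    rw [eq_comm, ← sub_eq_zero]
    simp only [F]
    rw [← map_sub, proj_eq_zero_iff, ← Finset.sum_sub_distrib]
    have : ∀ t : Finset s, ∑ v ∈ t, (c v • (v : Fin n → ℝ) - Int.fract (c v) • (v : Fin n → ℝ))
        ∈ intVectors n := by
      intro t
      rw [← proj_eq_zero_iff, map_sum]
      refine Finset.sum_eq_zero fun v _ => ?_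
      rw [← sub_smul, Int.self_sub_fract, proj_eq_zero_iff]
      exact smul_mem_intVectors (hs v.2).2 _
    exact this _
  · rintro ⟨c, -, rfl⟩
    exact ⟨_, W.sum_mem fun v _ => W.smul_mem _ (hs v.2).1, rfl⟩

/-- The torus of `W` is divisible, hence injective as an abelian group, so `Δ` retracts onto it. The
kernel of the retraction is the complement, and its order is the index of the torus. -/
lemma exists_complement {W : Submodule ℝ (Fin n → ℝ)} {Δ : AddSubgroup (Torus n)}
    (h : IsTangent W Δ) :
    ∃ H : AddSubgroup (Torus n), (H : Set (Torus n)).Finite ∧ torusOf W ⊓ H = ⊥ ∧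
      torusOf W ⊔ H = Δ := by
  have hdiv : ∀ {m : ℤ}, m ≠ 0 → Function.Surjective fun x : torusOf W => m • x := by
    rintro m hm ⟨_, w, hw, rfl⟩
    refine ⟨⟨proj n ((m : ℝ)⁻¹ • w), _, W.smul_mem _ hw, rfl⟩, Subtype.ext ?_⟩
    change m • proj n ((m : ℝ)⁻¹ • w) = proj n w
    rw [← map_zsmul, ← Int.cast_smul_eq_zsmul ℝ, smul_inv_smul₀ (by exact_mod_cast hm)]
  let _ : DivisibleBy (torusOf W) ℤ := divisibleByOfSMulRightSurj _ _ hdiv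
  obtain ⟨r, hr⟩ := (Module.Baer.of_divisible (torusOf W)).extension_property_addMonoidHom
    (AddSubgroup.inclusion h.le) (AddSubgroup.inclusion_injective h.le) (AddMonoidHom.id _)
  have hr' : ∀ x (hx : x ∈ torusOf W), r ⟨x, h.le hx⟩ = ⟨x, hx⟩ := fun x hx =>
    DFunLike.congr_fun hr ⟨x, hx⟩
  set H : AddSubgroup (Torus n) := r.ker.map Δ.subtype with hH
  have hmem : ∀ x, x ∈ H ↔ ∃ hx : x ∈ Δ, r ⟨x, hx⟩ = 0 := by
    intro x
    simp [hH, AddSubgroup.mem_map, AddMonoidHom.mem_ker]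
  have hinf : torusOf W ⊓ H = ⊥ := by
    refine (AddSubgroup.eq_bot_iff_forall _).2 fun x hx => ?_
    obtain ⟨hx1, hx2⟩ := AddSubgroup.mem_inf.1 hx
    obtain ⟨_, h0⟩ := (hmem x).1 hx2
    rw [hr' x hx1] at h0
    exact congrArg Subtype.val h0
  have hsup : torusOf W ⊔ H = Δ := by
    refine le_antisymm (sup_le h.le fun x hx => ((hmem x).1 hx).1) fun x hx => ?_
    have e : x = (r ⟨x, hx⟩ : Torus n) + (x - (r ⟨x, hx⟩ : Torus n)) := by abel
    rw [e]
    have hxr : (r ⟨x, hx⟩ : Torus n) ∈ Δ := h.le (r ⟨x, hx⟩).2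
    refine AddSubgroup.add_mem_sup (r ⟨x, hx⟩).2 ((hmem _).2 ⟨Δ.sub_mem hx hxr, ?_⟩)
    have : (⟨x - (r ⟨x, hx⟩ : Torus n), Δ.sub_mem hx hxr⟩ : Δ) = ⟨x, hx⟩ - ⟨_, hxr⟩ := rfl
    rw [this, map_sub, hr' _ (r ⟨x, hx⟩).2, sub_self]
  refine ⟨H, ?_, hinf, hsup⟩
  have h1 := h.relIndex_ne_zero
  rw [← hsup, AddSubgroup.relIndex_sup_left, ← AddSubgroup.inf_relIndex_right, hinf,
    AddSubgroup.relIndex_bot_left] at h1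
  exact Nat.finite_of_card_ne_zero h1

lemma IsTangent.isCompact {W : Submodule ℝ (Fin n → ℝ)} {Δ : AddSubgroup (Torus n)}
    (h : IsTangent W Δ) : IsCompact (Δ : Set (Torus n)) := by
  obtain ⟨H, hfin, -, hsup⟩ := exists_complement h
  have := (isCompact_torusOf h.isRational).add hfin.isCompact
  rwa [← AddSubgroup.normal_add, hsup] at this

lemma isSubgroupOfDim_iff {k : ℕ} {Δ : AddSubgroup (Torus n)} :
    IsSubgroupOfDim k Δ ↔ ∃ W, IsTangent W Δ ∧ Module.finrank ℝ W = k := by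
  constructor
  · rintro ⟨-, _, H, ⟨W, hW, hk, rfl⟩, hfin, -, rfl⟩
    refine ⟨W, ⟨hW, le_sup_left, ?_⟩, hk⟩
    rw [AddSubgroup.relIndex_sup_left]
    have : Finite H := hfin
    exact fun h0 => Nat.card_pos.ne' (zero_dvd_iff.1
      (h0 ▸ AddSubgroup.relIndex_dvd_card (torusOf W) H))
  · rintro ⟨W, h, hk⟩
    obtain ⟨H, hfin, hinf, hsup⟩ := exists_complement h
    exact ⟨h.isCompact.isClosed, torusOf W, H, ⟨W, h.isRational, hk, rfl⟩, hfin, hinf, hsup⟩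

/-- Every real multiple of `v` lies in `W + ℤ^n`. There are uncountably many multiples and countably
many integer vectors, so two multiples differ by an element of `W`. -/
lemma IsTangent.le_of_torusOf_le {W V : Submodule ℝ (Fin n → ℝ)} {Δ : AddSubgroup (Torus n)}
    (h : IsTangent W Δ) (hV : torusOf V ≤ Δ) : V ≤ W := by
  intro v hv
  have key : ∀ t : ℝ, ∃ z : Fin n → ℤ, t • v - toReal z ∈ W := by
    intro t
    -- The factorial of the index sends `Δ` into the torus of `W`; dividing `t • v` by it first
    -- stays inside `V`.
    have hN : ((((torusOf W).relIndex Δ).factorial : ℕ) : ℝ) ≠ 0 := by positivity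
    have hmem := AddSubgroup.nsmul_mem_of_relIndex_ne_zero_of_dvd h.relIndex_ne_zero
      (hV ⟨_, V.smul_mem ((((torusOf W).relIndex Δ).factorial : ℕ) : ℝ)⁻¹ (V.smul_mem t hv), rfl⟩)
      (n := ((torusOf W).relIndex Δ).factorial) fun m h0 h1 => Nat.dvd_factorial h0 h1
    rw [← map_nsmul, ← Nat.cast_smul_eq_nsmul ℝ, smul_inv_smul₀ hN] at hmem
    obtain ⟨w, hw, hwt⟩ := hmem.1
    rw [eq_comm, ← sub_eq_zero, ← map_sub, proj_eq_zero_iff] at hwt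
    obtain ⟨z, hz⟩ := exists_eq_toReal hwt
    exact ⟨z, by rw [← hz, sub_sub_cancel]; exact hw⟩
  choose z hz using key
  have hinj : ¬ Function.Injective z := fun hi => by
    have := hi.countable
    exact not_countable (α := ℝ) this
  obtain ⟨s, t, hst, hne⟩ : ∃ s t, z s = z t ∧ s ≠ t := by
    simpa [Function.Injective] using hinj
  have := W.sub_mem (hz s) (hz t)
  rw [hst, sub_sub_sub_cancel_right, ← sub_smul] at this
  exact (W.smul_mem_iff (sub_ne_zero.2 hne)).1 this

/-- By the modular law, an intermediate `K` is determined by its intersection with the finite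
complement `H`. -/
lemma IsTangent.finite_between {W : Submodule ℝ (Fin n → ℝ)} {Δ : AddSubgroup (Torus n)}
    (h : IsTangent W Δ) : {K : AddSubgroup (Torus n) | torusOf W ≤ K ∧ K ≤ Δ}.Finite := by
  obtain ⟨H, hfin, -, hsup⟩ := exists_complement h
  refine Set.Finite.of_finite_image (f := fun K => ((K ⊓ H : AddSubgroup _) : Set (Torus n)))
    (hfin.finite_subsets.subset ?_) ?_
  · rintro _ ⟨K, -, rfl⟩
    exact Set.inter_subset_right
  · have key : ∀ K : AddSubgroup (Torus n), torusOf W ≤ K ∧ K ≤ Δ → K = torusOf W ⊔ H ⊓ K := by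
      rintro K ⟨h1, h2⟩
      rw [← sup_inf_assoc_of_le _ h1, hsup, inf_eq_right.2 h2]
    intro K hK L hL hKL
    have hKL' : K ⊓ H = L ⊓ H := SetLike.coe_injective hKL
    rw [key K hK, key L hL, inf_comm, hKL', inf_comm]

/-! ### Distances to the center -/

lemma norm_coe_le_abs (t : ℝ) : ‖(t : UnitAddCircle)‖ ≤ |t| := by
  rw [UnitAddCircle.norm_eq]
  simpa using round_le t 0

lemma exists_coe_eq_abs_eq (x : UnitAddCircle) :
    ∃ t : ℝ, (t : UnitAddCircle) = x ∧ |t| = ‖x‖ := by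
  obtain ⟨s, rfl⟩ := QuotientAddGroup.mk_surjective x
  refine ⟨s - round s, ?_, (UnitAddCircle.norm_eq).symm⟩
  rw [AddCircle.coe_sub, sub_eq_self, AddCircle.coe_eq_zero_iff]
  exact ⟨round s, by simp⟩

lemma norm_coe_eq_abs {t : ℝ} (ht : |t| ≤ 1 / 2) : ‖(t : UnitAddCircle)‖ = |t| :=
  (AddCircle.norm_coe_eq_abs_iff (p := (1 : ℝ)) one_ne_zero).2 (by simpa using ht)

lemma norm_proj_le (y : Fin n → ℝ) : ‖proj n y‖ ≤ ‖y‖ :=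
  (pi_norm_le_iff_of_nonneg (norm_nonneg _)).2 fun i =>
    (norm_coe_le_abs (y i)).trans (norm_le_pi_norm y i)

lemma dist_center_add_proj_le (y : Fin n → ℝ) : dist (center n) (center n + proj n y) ≤ ‖y‖ := by
  rw [dist_comm, dist_eq_norm, add_sub_cancel_left]
  exact norm_proj_le y

lemma exists_lift (x : Torus n) :
    ∃ y : Fin n → ℝ, x = center n + proj n y ∧ ∀ i, |y i| = dist (center n i) (x i) := by
  choose y hy hy' using fun i => exists_coe_eq_abs_eq (x i - center n i)
  refine ⟨y, ?_, fun i => ?_⟩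
  · ext i
    simp [hy]
  · rw [hy', dist_comm, dist_eq_norm]

lemma norm_lift {x : Torus n} {y : Fin n → ℝ} (hy : ∀ i, |y i| = dist (center n i) (x i)) :
    ‖y‖ = dist (center n) x := by
  refine le_antisymm ((pi_norm_le_iff_of_nonneg dist_nonneg).2 fun i => ?_)
    ((dist_pi_le_iff (norm_nonneg _)).2 fun i => ?_)
  · rw [Real.norm_eq_abs, hy]; exact dist_le_pi_dist _ _ i
  · rw [← hy]; exact norm_le_pi_norm y i

lemma center_apply (i : Fin n) : center n i = ((1 / 2 : ℝ) : UnitAddCircle) := rfl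

lemma dist_half_lt_iff (x : UnitAddCircle) :
    dist (((1 / 2 : ℝ)) : UnitAddCircle) x < 1 / 2 ↔ x ≠ 0 := by
  constructor
  · rintro h rfl
    rw [dist_zero_right, norm_coe_eq_abs (by norm_num [abs_of_pos])] at h
    norm_num [abs_of_pos] at h
  · intro hx
    obtain ⟨t, rfl⟩ := QuotientAddGroup.mk_surjective x
    have e : ((t : ℝ) : UnitAddCircle) = (Int.fract t : ℝ) := by
      conv_lhs => rw [← Int.floor_add_fract t, AddCircle.coe_add]
      rw [add_eq_right, AddCircle.coe_eq_zero_iff]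
      exact ⟨⌊t⌋, by simp⟩
    change ((t : ℝ) : UnitAddCircle) ≠ 0 at hx
    change dist (((1 / 2 : ℝ)) : UnitAddCircle) ((t : ℝ) : UnitAddCircle) < 1 / 2
    rw [e] at hx ⊢
    have h0 : Int.fract t ≠ 0 := by
      intro h0; exact hx (by rw [h0, AddCircle.coe_zero])
    have h1 := lt_of_le_of_ne (Int.fract_nonneg t) (Ne.symm h0)
    have h2 := Int.fract_lt_one t
    rw [dist_eq_norm, ← AddCircle.coe_sub]
    exact (norm_coe_le_abs _).trans_lt (abs_lt.2 ⟨by linarith, by linarith⟩)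

lemma dist_center_lt_iff (x : Torus n) : dist (center n) x < 1 / 2 ↔ ∀ i, x i ≠ 0 := by
  rw [dist_pi_lt_iff (by norm_num)]
  exact forall_congr' fun i => dist_half_lt_iff (x i)

/-- This turns properness into a strict inequality on `D`, inherited by larger subgroups and by
subgroups with nearby values. -/
lemma isProper_iff_D_lt (Δ : AddSubgroup (Torus n)) :
    IsProper (Δ : Set (Torus n)) ↔ D (Δ : Set (Torus n)) < 1 / 2 := by
  rw [D, Metric.infDist_lt_iff ⟨0, Δ.zero_mem⟩]
  simp only [dist_center_lt_iff, IsProper, Set.not_subset]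
  simp

lemma D_le_dist {Δ : AddSubgroup (Torus n)} {x : Torus n} (hx : x ∈ Δ) :
    D (Δ : Set (Torus n)) ≤ dist (center n) x :=
  Metric.infDist_le_dist_of_mem hx

lemma D_anti {Δ Δ' : AddSubgroup (Torus n)} (h : Δ ≤ Δ') :
    D (Δ' : Set (Torus n)) ≤ D (Δ : Set (Torus n)) :=
  Metric.infDist_le_infDist_of_subset h ⟨0, Δ.zero_mem⟩

lemma D_nonneg (X : Set (Torus n)) : 0 ≤ D X := Metric.infDist_nonneg

lemma IsTangent.exists_dist_eq {W : Submodule ℝ (Fin n → ℝ)} {Δ : AddSubgroup (Torus n)}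
    (h : IsTangent W Δ) : ∃ x ∈ Δ, dist (center n) x = D (Δ : Set (Torus n)) := by
  obtain ⟨x, hx, he⟩ := h.isCompact.exists_infDist_eq_dist ⟨0, Δ.zero_mem⟩ (center n)
  exact ⟨x, hx, he.symm⟩

lemma D_le_add_of_near {Δ Δ' : AddSubgroup (Torus n)} {ε : ℝ}
    (h : ∀ x ∈ Δ, ∃ y ∈ Δ', dist x y ≤ ε) :
    D (Δ' : Set (Torus n)) ≤ D (Δ : Set (Torus n)) + ε := by
  rw [← sub_le_iff_le_add]
  refine (Metric.le_infDist ⟨0, Δ.zero_mem⟩).2 fun x hx => ?_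
  obtain ⟨y, hy, hxy⟩ := h x hx
  have := D_le_dist hy
  have := dist_triangle (center n) x y
  linarith

/-! ### Characters separate points from closed subgroups -/

lemma toCircle_sum {ι : Type*} (s : Finset ι) (f : ι → UnitAddCircle) :
    ((∑ i ∈ s, f i).toCircle : ℂ) = ∏ i ∈ s, ((f i).toCircle : ℂ) := by
  classical
  induction s using Finset.induction_on with
  | empty => simp
  | insert i s hi ih =>
    rw [Finset.sum_insert hi, Finset.prod_insert hi, AddCircle.toCircle_add, ← ih, Circle.coe_mul]

open MeasureTheory in
-- Otherwise Haar measure on `Δ` and its translate by `x₀` have the same Fourier coefficients: a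
-- character trivial on `Δ` is then trivial at `x₀`, and any other integrates to 0 over `Δ`. By
-- density of trigonometric polynomials the two measures agree on all continuous functions, against
-- a Urysohn function separating `Δ` from `x₀ + Δ`.
lemma exists_chr_ne_zero {Δ : AddSubgroup (Torus n)} (hΔ : IsClosed (Δ : Set (Torus n)))
    {x₀ : Torus n} (hx₀ : x₀ ∉ Δ) :
    ∃ a : Fin n → ℤ, (∀ x ∈ Δ, chr a x = 0) ∧ chr a x₀ ≠ 0 := by
  by_contra! hcon
  have hcomp : CompactSpace Δ := isCompact_iff_compactSpace.1 hΔ.isCompact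
  let _ : MeasurableSpace Δ := borel Δ
  have : BorelSpace Δ := ⟨rfl⟩
  let μ : Measure Δ := Measure.addHaar
  have hmf : ∀ a (x : Torus n), UnitAddTorus.mFourier a x = (chr a x).toCircle := by
    intro a x
    rw [chr_apply, toCircle_sum]
    simp [UnitAddTorus.mFourier, fourier_apply]
  have h_integrable : ∀ g : C(Torus n, ℂ), Integrable (fun y : Δ => g y - g (x₀ + y)) μ := by
    intro g
    have hc : Continuous fun y : Δ => g y - g (x₀ + y) := by fun_prop
    exact hc.integrable_of_hasCompactSupport (HasCompactSupport.of_compactSpace _)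
  let L : C(Torus n, ℂ) →ₗ[ℂ] ℂ :=
    { toFun := fun g => ∫ y : Δ, (g y - g (x₀ + y)) ∂μ
      map_add' := fun g g' => by
        rw [← integral_add (h_integrable g) (h_integrable g')]
        congr 1; ext y; simp; ring
      map_smul' := fun c g => by
        simp only [ContinuousMap.smul_apply, ← smul_sub, integral_smul, RingHom.id_apply] }
  have hLc : Continuous L := by
    refine (L.mkContinuous (2 * μ.real Set.univ) fun g => ?_).continuous
    have := norm_integral_le_of_norm_le_const (μ := μ) (C := 2 * ‖g‖)
      (f := fun y : Δ => g y - g (x₀ + y)) (Eventually.of_forall fun y => by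
        have h1 := g.norm_coe_le_norm (y : Torus n)
        have h2 := g.norm_coe_le_norm (x₀ + y)
        have h3 := norm_sub_le (g y) (g (x₀ + y))
        linarith)
    refine this.trans (le_of_eq (by ring))
  have hL0 : ∀ a, L (UnitAddTorus.mFourier a) = 0 := by
    intro a
    change ∫ y : Δ, (UnitAddTorus.mFourier a (y : Torus n)
      - UnitAddTorus.mFourier a (x₀ + (y : Torus n))) ∂μ = 0
    by_cases ha : ∀ x ∈ Δ, chr a x = 0
    · have h0 := hcon a ha
      have : ∀ y : Δ, UnitAddTorus.mFourier a (y : Torus n)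
          - UnitAddTorus.mFourier a (x₀ + (y : Torus n)) = 0 := fun y => by
        rw [hmf, hmf, map_add, h0, ha y y.2]; simp
      simp [this]
    · push Not at ha
      obtain ⟨x₁, hx₁, h1⟩ := ha
      have hfac : ∀ y : Δ, UnitAddTorus.mFourier a (y : Torus n)
          - UnitAddTorus.mFourier a (x₀ + (y : Torus n))
          = (1 - (chr a x₀).toCircle) * UnitAddTorus.mFourier a (y : Torus n) := fun y => by
        rw [hmf, hmf, map_add, AddCircle.toCircle_add]; push_cast; ring
      simp_rw [hfac]
      rw [integral_const_mul]
      have htr := integral_add_left_eq_self (μ := μ)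
        (fun y : Δ => UnitAddTorus.mFourier a (y : Torus n)) ⟨x₁, hx₁⟩
      have hfac' : ∀ y : Δ, UnitAddTorus.mFourier a (((⟨x₁, hx₁⟩ + y : Δ)) : Torus n)
          = (chr a x₁).toCircle * UnitAddTorus.mFourier a (y : Torus n) := fun y => by
        rw [hmf, hmf, AddSubgroup.coe_add, map_add, AddCircle.toCircle_add]; push_cast; rfl
      simp_rw [hfac'] at htr
      rw [integral_const_mul] at htr
      have hne : ((chr a x₁).toCircle : ℂ) ≠ 1 := by
        intro h
        apply h1
        apply AddCircle.injective_toCircle (T := 1) one_ne_zero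
        rw [AddCircle.toCircle_zero]
        exact Subtype.ext h
      rcases mul_left_eq_self₀.1 htr with h | h
      · exact absurd h hne
      · rw [h, mul_zero]
  have hLtop : ∀ g, L g = 0 := by
    intro g
    have hg : g ∈ (Submodule.span ℂ
        (Set.range (UnitAddTorus.mFourier (d := Fin n)))).topologicalClosure := by
      rw [UnitAddTorus.span_mFourier_closure_eq_top]; trivial
    have hker : IsClosed {g | L g = 0} := isClosed_eq hLc continuous_const
    refine closure_minimal (s := (Submodule.span ℂ
        (Set.range (UnitAddTorus.mFourier (d := Fin n))) : Set C(Torus n, ℂ))) ?_ hker hg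
    intro g hg
    have : Submodule.span ℂ (Set.range (UnitAddTorus.mFourier (d := Fin n))) ≤ LinearMap.ker L :=
      Submodule.span_le.2 (by rintro _ ⟨a, rfl⟩; exact hL0 a)
    exact this hg
  have hcl : IsClosed ((fun y => x₀ + y) '' (Δ : Set (Torus n))) :=
    (hΔ.isCompact.image (by fun_prop)).isClosed
  have hdisj : Disjoint (Δ : Set (Torus n)) ((fun y => x₀ + y) '' (Δ : Set (Torus n))) := by
    rw [Set.disjoint_left]
    rintro _ hy ⟨y, hy', rfl⟩
    exact hx₀ ((AddSubgroup.add_mem_cancel_right _ hy').1 hy)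
  obtain ⟨f, hf0, hf1, -⟩ := exists_continuous_zero_one_of_isClosed hΔ hcl hdisj
  let g : C(Torus n, ℂ) := ⟨fun x => (f x : ℂ), by fun_prop⟩
  have hg := hLtop g
  have : ∀ y : Δ, g y - g (x₀ + y) = -1 := fun y => by
    have e0 : f y = 0 := hf0 y.2
    have e1 : f (x₀ + y) = 1 := hf1 ⟨y, y.2, rfl⟩
    simp [g, e0, e1]
  change ∫ y : Δ, (g y - g (x₀ + y)) ∂μ = 0 at hg
  simp_rw [this] at hg
  rw [integral_const] at hg
  have hpos : μ.real Set.univ ≠ 0 := by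
    rw [Ne, measureReal_eq_zero_iff]
    exact (isOpen_univ.measure_pos μ ⟨0, trivial⟩).ne'
  simp [hpos] at hg

/-! ### Limits of subgroups along ultrafilters -/

/-- The circle has no small subgroups; this gives a uniform lower bound that survives passage to
limits. -/
lemma exists_nsmul_norm_ge {x : UnitAddCircle} (hx : x ≠ 0) : ∃ m : ℕ, 1 / 4 ≤ ‖m • x‖ := by
  obtain ⟨t, rfl, ht⟩ := exists_coe_eq_abs_eq x
  by_cases h : 1 / 4 ≤ |t|
  · exact ⟨1, by rw [one_smul, ← ht]; exact h⟩
  · push Not at h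
    have hpos : 0 < |t| := by
      rw [ht]; exact norm_pos_iff.2 hx
    set m := ⌈1 / 4 / |t|⌉₊ with hm
    have h1 : 1 / 4 ≤ m * |t| := by
      rw [← div_le_iff₀ hpos]; exact Nat.le_ceil _
    have h2 : m * |t| < 1 / 4 + |t| := by
      have := Nat.ceil_lt_add_one (a := 1 / 4 / |t|) (by positivity)
      rw [← hm] at this
      calc m * |t| < (1 / 4 / |t| + 1) * |t| := by gcongr
        _ = 1 / 4 + |t| := by field_simp
    refine ⟨m, ?_⟩
    have habs : |(m : ℝ) * t| = m * |t| := by rw [abs_mul, Nat.abs_cast]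
    rw [← AddCircle.coe_nsmul, nsmul_eq_mul, norm_coe_eq_abs] <;> rw [habs] <;> linarith

variable {ι : Type*}

/-- The integer vectors whose characters are eventually trivial on the `Δ i`. -/
def limitAnnihilator (U : Ultrafilter ι) (Δ : ι → AddSubgroup (Torus n)) :
    AddSubgroup (Fin n → ℤ) where
  carrier := {a | ∀ᶠ i in (U : Filter ι), ∀ x ∈ Δ i, chr a x = 0}
  zero_mem' := Eventually.of_forall fun i x _ => chr_zero x
  add_mem' := fun ha hb => by
    filter_upwards [ha, hb] with i h1 h2 x hx
    rw [chr_add, h1 x hx, h2 x hx, add_zero]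
  neg_mem' := fun ha => by
    filter_upwards [ha] with i h1 x hx
    rw [chr_neg, h1 x hx, neg_zero]

/-- The limits of families of points of the `Δ i` along an ultrafilter. -/
def limitPoints (U : Ultrafilter ι) (Δ : ι → AddSubgroup (Torus n)) :
    AddSubgroup (Torus n) where
  carrier := {x | ∀ ε > 0, ∀ᶠ i in (U : Filter ι), ∃ y ∈ Δ i, dist x y < ε}
  zero_mem' := fun ε hε => Eventually.of_forall fun i => ⟨0, (Δ i).zero_mem, by simpa using hε⟩
  add_mem' := fun {x x'} hx hx' ε hε => by
    filter_upwards [hx (ε / 2) (half_pos hε), hx' (ε / 2) (half_pos hε)] with i h1 h2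
    obtain ⟨y, hy, hxy⟩ := h1
    obtain ⟨y', hy', hxy'⟩ := h2
    exact ⟨y + y', (Δ i).add_mem hy hy', (dist_add_add_le _ _ _ _).trans_lt (by linarith)⟩
  neg_mem' := fun {x} hx ε hε => by
    filter_upwards [hx ε hε] with i h1
    obtain ⟨y, hy, hxy⟩ := h1
    exact ⟨-y, (Δ i).neg_mem hy, by rwa [dist_neg_neg]⟩

lemma isClosed_limitPoints (U : Ultrafilter ι) (Δ : ι → AddSubgroup (Torus n)) :
    IsClosed (limitPoints U Δ : Set (Torus n)) := by
  refine isClosed_of_closure_subset fun x hx ε hε => ?_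
  obtain ⟨x', hx', hd⟩ := Metric.mem_closure_iff.1 hx (ε / 2) (half_pos hε)
  filter_upwards [hx' (ε / 2) (half_pos hε)] with i h1
  obtain ⟨y, hy, hxy⟩ := h1
  exact ⟨y, hy, (dist_triangle x x' y).trans_lt (by linarith)⟩

/-- If `x` is not a limit point, some character `a` kills all limit points but not `x`. Then `a` is
eventually nontrivial on `Δ i`, hence takes values of norm at least 1/4 there. A limit of points
with such values is a limit point not killed by `a`. -/
lemma mem_limitPoints {U : Ultrafilter ι} {Δ : ι → AddSubgroup (Torus n)} {x : Torus n}
    (hx : ∀ a ∈ limitAnnihilator U Δ, chr a x = 0) : x ∈ limitPoints U Δ := by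
  by_contra hx'
  obtain ⟨a, ha, hax⟩ := exists_chr_ne_zero (isClosed_limitPoints U Δ) hx'
  have hna : a ∉ limitAnnihilator U Δ := fun h => hax (hx a h)
  have hev : ∀ᶠ i in (U : Filter ι), ∃ y ∈ Δ i, 1 / 4 ≤ ‖chr a y‖ := by
    have : ∀ᶠ i in (U : Filter ι), ¬ ∀ x ∈ Δ i, chr a x = 0 :=
      -- Here it matters that `U` is an ultrafilter: not eventually trivial means eventually
      -- nontrivial.
      Ultrafilter.eventually_not.2 hna
    filter_upwards [this] with i hi
    push Not at hi
    obtain ⟨y, hy, h0⟩ := hi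
    obtain ⟨m, hm⟩ := exists_nsmul_norm_ge h0
    exact ⟨m • y, (Δ i).nsmul_mem hy m, by rwa [map_nsmul]⟩
  classical
  let y : ι → Torus n := fun i => if h : ∃ y ∈ Δ i, 1 / 4 ≤ ‖chr a y‖ then h.choose else 0
  have hy : ∀ᶠ i in (U : Filter ι), y i ∈ Δ i ∧ 1 / 4 ≤ ‖chr a (y i)‖ := by
    filter_upwards [hev] with i hi
    simp only [y, dif_pos hi]
    exact hi.choose_spec
  obtain ⟨z, -, hz⟩ := isCompact_univ.ultrafilter_le_nhds (U.map y) (by simp)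
  have hz' : Tendsto y U (𝓝 z) := hz
  have hzmem : z ∈ limitPoints U Δ := by
    intro ε hε
    filter_upwards [hy, hz' (Metric.ball_mem_nhds z hε)] with i h1 h2
    exact ⟨y i, h1.1, by rw [dist_comm]; exact h2⟩
  have hnorm : 1 / 4 ≤ ‖chr a z‖ := by
    have ht : Tendsto (fun i => ‖chr a (y i)‖) U (𝓝 ‖chr a z‖) :=
      ((continuous_chr a).norm.tendsto z).comp hz'
    exact ge_of_tendsto ht (hy.mono fun i h => h.2)
  rw [ha z hzmem, norm_zero] at hnorm
  norm_num at hnorm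

lemma exists_isTangent_annihilator (s : Finset (Fin n → ℤ)) :
    ∃ (Δ : AddSubgroup (Torus n)) (W : Submodule ℝ (Fin n → ℝ)), IsTangent W Δ ∧
      ∀ x, x ∈ Δ ↔ ∀ a ∈ s, chr a x = 0 := by
  classical
  induction s using Finset.induction_on with
  | empty =>
    refine ⟨⊤, ⊤, ?_, by simp⟩
    have := isTangent_torusOf (isRational_top (n := n))
    rwa [torusOf_top] at this
  | insert a s ha ih =>
    obtain ⟨Δ, W, h, hmem⟩ := ih
    refine ⟨_, _, h.inf_ker a, fun x => ?_⟩
    rw [AddSubgroup.mem_inf, hmem, AddMonoidHom.mem_ker]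
    simp [and_comm]

/-- The limit annihilator is finitely generated, as a subgroup of `ℤ^n`, so finitely many eventual
conditions suffice for `Δ i ≤ Δ'`. -/
theorem exists_limit (U : Ultrafilter ι) (Δ : ι → AddSubgroup (Torus n)) :
    ∃ (Δ' : AddSubgroup (Torus n)) (W : Submodule ℝ (Fin n → ℝ)), IsTangent W Δ' ∧
      (∀ᶠ i in (U : Filter ι), Δ i ≤ Δ') ∧
      ∀ x ∈ Δ', ∀ ε > 0, ∀ᶠ i in (U : Filter ι), ∃ y ∈ Δ i, dist x y < ε := by
  obtain ⟨s, hs⟩ : (AddSubgroup.toIntSubmodule (limitAnnihilator U Δ)).FG :=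
    IsNoetherian.noetherian _
  have hs' : AddSubgroup.closure (s : Set (Fin n → ℤ)) = limitAnnihilator U Δ := by
    have := congrArg Submodule.toAddSubgroup hs
    rw [Submodule.span_int_eq_addSubgroupClosure] at this
    simpa using this
  obtain ⟨Δ', W, hW, hmem⟩ := exists_isTangent_annihilator s
  refine ⟨Δ', W, hW, ?_, ?_⟩
  · have : ∀ᶠ i in (U : Filter ι), ∀ a ∈ s, ∀ x ∈ Δ i, chr a x = 0 := by
      rw [Filter.eventually_all_finset]
      intro a ha
      have : a ∈ limitAnnihilator U Δ := by
        rw [← hs']; exact AddSubgroup.subset_closure ha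
      exact this
    filter_upwards [this] with i hi x hx
    exact (hmem x).2 fun a ha => hi a ha x hx
  · intro x hx
    refine mem_limitPoints (U := U) (Δ := Δ) fun a ha => ?_
    rw [← hs'] at ha
    induction ha using AddSubgroup.closure_induction with
    | mem a ha => exact (hmem x).1 hx a ha
    | zero => exact chr_zero x
    | add a b _ _ h1 h2 => rw [chr_add, h1, h2, add_zero]
    | neg a _ h1 => rw [chr_neg, h1, neg_zero]

lemma tendsto_D_of_limit {U : Ultrafilter ι} {Δ : ι → AddSubgroup (Torus n)}
    {Δ' : AddSubgroup (Torus n)} (hle : ∀ᶠ i in (U : Filter ι), Δ i ≤ Δ')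
    (hnear : ∀ x ∈ Δ', ∀ ε > 0, ∀ᶠ i in (U : Filter ι), ∃ y ∈ Δ i, dist x y < ε) :
    Tendsto (fun i => D (Δ i : Set (Torus n))) U (𝓝 (D (Δ' : Set (Torus n)))) := by
  rw [Metric.tendsto_nhds]
  intro ε hε
  obtain ⟨x, hx, hd⟩ : ∃ x ∈ (Δ' : Set (Torus n)), dist (center n) x
      < D (Δ' : Set (Torus n)) + ε / 2 :=
    (Metric.infDist_lt_iff ⟨0, Δ'.zero_mem⟩).1 (lt_add_of_pos_right _ (half_pos hε))
  filter_upwards [hle, hnear x hx (ε / 2) (half_pos hε)] with i h1 h2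
  obtain ⟨y, hy, hxy⟩ := h2
  have h3 := D_anti h1
  have h4 := D_le_dist hy
  have h5 := dist_triangle (center n) x y
  rw [Real.dist_eq, abs_of_nonneg (by linarith)]
  linarith

/-! ### Density points -/

lemma mem_den_iff {α : Type*} (P : Set α) (f : α → ℝ) (x : ℝ) :
    x ∈ den (fun d => Set.encard {a | a ∈ P ∧ f a = d}) ↔
      ∀ ε > 0, {a | a ∈ P ∧ |f a - x| < ε}.Infinite := by
  have hset : {d : ℝ | Set.encard {a | a ∈ P ∧ f a = d} ≠ 0} = f '' P := by
    ext d
    simp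
  rw [den, hset]
  constructor
  · rintro (h | h) ε hε
    · have h1 : (Metric.ball x ε ∩ f '' P).Infinite :=
        Set.Infinite.of_accPt (AccPt.nhds_inter h (Metric.ball_mem_nhds x hε))
      refine Set.Infinite.of_image f (h1.mono ?_)
      rintro _ ⟨hb, a, ha, rfl⟩
      exact ⟨a, ⟨ha, by simpa [Real.dist_eq] using hb⟩, rfl⟩
    · refine (Set.encard_eq_top_iff.1 h).mono ?_
      rintro a ⟨ha, rfl⟩
      exact ⟨ha, by simpa using hε⟩
  · intro h
    by_cases hx : {a | a ∈ P ∧ f a = x}.Infinite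
    · exact Or.inr (Set.encard_eq_top_iff.2 hx)
    · left
      rw [Set.not_infinite] at hx
      change AccPt x (𝓟 (f '' P))
      rw [accPt_iff_nhds]
      intro V hV
      obtain ⟨ε, hε, hb⟩ := Metric.mem_nhds_iff.1 hV
      obtain ⟨a, ⟨ha, hd⟩, hne⟩ := ((h ε hε).sdiff hx).nonempty
      exact ⟨f a, ⟨hb (by simpa [Real.dist_eq] using hd), a, ha, rfl⟩, fun e => hne ⟨ha, e⟩⟩

lemma acc_subset_den {α : Type*} (P : Set α) (f : α → ℝ) :
    acc (f '' P) ⊆ den (fun d => Set.encard {a | a ∈ P ∧ f a = d}) := by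
  intro x hx
  left
  convert hx using 2
  ext d
  simp

/-- A point near which infinitely many members of a family have their values is the limit of these
values along a nonprincipal ultrafilter. -/
lemma exists_ultrafilter {α : Type*} {P : Set α} {f : α → ℝ} {x : ℝ}
    (h : ∀ ε > 0, {a | a ∈ P ∧ |f a - x| < ε}.Infinite) :
    ∃ U : Ultrafilter α, (U : Filter α) ≤ cofinite ∧ (∀ᶠ a in (U : Filter α), a ∈ P) ∧
      Tendsto f U (𝓝 x) := by
  set F := cofinite ⊓ (𝓟 P ⊓ comap f (𝓝 x)) with hF
  have hne : F.NeBot := by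
    rw [hF, inf_neBot_iff]
    intro s hs s' hs'
    obtain ⟨t₁, ht₁, t₂, ⟨V, hV, hVt⟩, rfl⟩ := mem_inf_iff.1 hs'
    obtain ⟨ε, hε, hb⟩ := Metric.mem_nhds_iff.1 hV
    obtain ⟨a, ⟨ha, hd⟩, hs''⟩ := ((h ε hε).sdiff (mem_cofinite.1 hs)).nonempty
    exact ⟨a, not_not.1 hs'', ht₁ ha, hVt (hb (by simpa [Real.dist_eq] using hd))⟩
  refine ⟨Ultrafilter.of F, (Ultrafilter.of_le _).trans inf_le_left, ?_, ?_⟩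
  · exact (Ultrafilter.of_le _).trans (inf_le_right.trans inf_le_left) (mem_principal_self P)
  · exact tendsto_iff_comap.2 ((Ultrafilter.of_le _).trans (inf_le_right.trans inf_le_right))

/-- The values of `D` on a family of subgroups accumulate only from above. -/
theorem hasOnlyUpperAcc_D (P : Set (AddSubgroup (Torus n))) :
    HasOnlyUpperAcc ((fun Δ : AddSubgroup (Torus n) => D (Δ : Set (Torus n))) '' P) := by
  intro x hx
  set A := (fun Δ : AddSubgroup (Torus n) => D (Δ : Set (Torus n))) '' P with hA
  have hlow : ¬ IsLowerAcc A x := by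
    intro hl
    have : ∀ m : ℕ, ∃ Δ : AddSubgroup (Torus n),
        D (Δ : Set (Torus n)) ∈ Set.Ioo (x - 1 / ((m : ℝ) + 1)) x := fun m => by
      obtain ⟨_, ⟨Δ, -, rfl⟩, h⟩ := hl (1 / ((m : ℝ) + 1)) (by positivity)
      exact ⟨Δ, h⟩
    choose Δ hΔ using this
    let U : Ultrafilter ℕ := hyperfilter ℕ
    obtain ⟨Δ', W, -, hle, hnear⟩ := exists_limit U Δ
    have ht := tendsto_D_of_limit hle hnear
    have ht' : Tendsto (fun m => D (Δ m : Set (Torus n))) U (𝓝 x) := by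
      have h1 : Tendsto (fun m : ℕ => x - 1 / ((m : ℝ) + 1)) atTop (𝓝 x) := by
        simpa using tendsto_const_nhds.sub (tendsto_one_div_add_atTop_nhds_zero_nat (𝕜 := ℝ))
      have h2 : Tendsto (fun m => D (Δ m : Set (Torus n))) atTop (𝓝 x) :=
        tendsto_of_tendsto_of_tendsto_of_le_of_le h1 tendsto_const_nhds
          (fun m => (hΔ m).1.le) (fun m => (hΔ m).2.le)
      exact h2.mono_left Nat.hyperfilter_le_atTop
    have he : D (Δ' : Set (Torus n)) = x := tendsto_nhds_unique ht ht'
    -- A member contained in the limit has `D` at least `x`, while all chosen members have `D` below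
    -- `x`.
    obtain ⟨m, hm⟩ := hle.exists
    have := D_anti hm
    linarith [(hΔ m).2]
  refine ⟨?_, hlow⟩
  simp only [IsLowerAcc, not_forall] at hlow
  obtain ⟨δ, hδ, hδ'⟩ := hlow
  intro ε hε
  have hx' : AccPt x (𝓟 A) := hx
  rw [accPt_iff_nhds] at hx'
  obtain ⟨y, ⟨hy, hyA⟩, hne⟩ := hx' (Set.Ioo (x - δ) (x + ε))
    (Ioo_mem_nhds (by linarith) (by linarith))
  rcases lt_or_gt_of_ne hne with h | h
  · exact absurd ⟨y, hyA, hy.1, h⟩ hδ'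
  · exact ⟨y, hyA, h, hy.2⟩

/-! ### Points of an affine subspace closest to the origin -/

/-- Among the sup-norm minimizers in `y + W`, take `u` of largest Euclidean norm. If `w` vanishes on
the active coordinates, then `u ± t w` are minimizers for small `t`, and the parallelogram identity
forces `w = 0`. -/
lemma exists_extreme (W : Submodule ℝ (Fin n → ℝ)) {y : Fin n → ℝ} {d : ℝ} (hy : ‖y‖ = d)
    (hmin : ∀ w ∈ W, d ≤ ‖y + w‖) :
    ∃ w₀ ∈ W, ‖y + w₀‖ = d ∧ ∀ w ∈ W, (∀ i, |(y + w₀) i| = d → w i = 0) → w = 0 := by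
  let K : Set (Fin n → ℝ) := (fun v => v - y) ⁻¹' (W : Set (Fin n → ℝ)) ∩ Metric.closedBall 0 d
  have hK : IsCompact K :=
    (isCompact_closedBall _ _).inter_left
      (W.closed_of_finiteDimensional.preimage (by fun_prop))
  have hne : K.Nonempty := ⟨y, by simp, by simp [hy]⟩
  obtain ⟨u, ⟨huW, hud⟩, humax⟩ := hK.exists_isMaxOn hne
    (f := fun v : Fin n → ℝ => ∑ i, v i ^ 2) (by fun_prop)
  have hud' : ‖u‖ ≤ d := by simpa using hud
  have huy : y + (u - y) = u := by abel
  refine ⟨u - y, huW, ?_, fun w hw h0 => ?_⟩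
  · exact le_antisymm (by rwa [huy]) (hmin _ huW)
  rw [huy] at h0
  have hsmall : ∀ᶠ t : ℝ in 𝓝[>] 0, ∀ i, |u i + t * w i| ≤ d ∧ |u i - t * w i| ≤ d := by
    rw [eventually_all]
    intro i
    have hui : |u i| ≤ d := (norm_le_pi_norm u i).trans hud'
    rcases hui.eq_or_lt with h | h
    · simp [h0 i h, h]
    · have c1 : Tendsto (fun t : ℝ => |u i + t * w i|) (𝓝[>] 0) (𝓝 |u i|) := by
        have : Continuous fun t : ℝ => |u i + t * w i| := by fun_prop
        simpa using (this.tendsto 0).mono_left nhdsWithin_le_nhds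
      have c2 : Tendsto (fun t : ℝ => |u i - t * w i|) (𝓝[>] 0) (𝓝 |u i|) := by
        have : Continuous fun t : ℝ => |u i - t * w i| := by fun_prop
        simpa using (this.tendsto 0).mono_left nhdsWithin_le_nhds
      filter_upwards [c1.eventually_le_const h, c2.eventually_le_const h] with t h1 h2
      exact ⟨h1, h2⟩
  obtain ⟨t, ht, htpos⟩ := (hsmall.and self_mem_nhdsWithin).exists
  have htpos' : 0 < t := htpos
  have hd0 : 0 ≤ d := (norm_nonneg _).trans hud'
  have hmem : ∀ c : ℝ, (∀ i, |u i + c * w i| ≤ d) → u + c • w ∈ K := fun c hc => by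
    refine ⟨?_, ?_⟩
    · have : u + c • w - y = (u - y) + c • w := by abel
      change u + c • w - y ∈ W
      rw [this]
      exact W.add_mem huW (W.smul_mem c hw)
    · rw [mem_closedBall_zero_iff, pi_norm_le_iff_of_nonneg hd0]
      intro i
      simpa using hc i
  have m1 := humax (hmem t fun i => (ht i).1)
  have m2 := humax (hmem (-t) fun i => by simpa [sub_eq_add_neg] using (ht i).2)
  simp only [Set.mem_ofPred_eq, Pi.add_apply, Pi.smul_apply, smul_eq_mul] at m1 m2
  have hsum : ∑ i, (u i + t * w i) ^ 2 + ∑ i, (u i + -t * w i) ^ 2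
      = 2 * ∑ i, u i ^ 2 + 2 * t ^ 2 * ∑ i, w i ^ 2 := by
    rw [Finset.mul_sum, Finset.mul_sum, ← Finset.sum_add_distrib, ← Finset.sum_add_distrib]
    exact Finset.sum_congr rfl fun i _ => by ring
  have hw0 : ∑ i, w i ^ 2 ≤ 0 := by
    by_contra! hpos
    have : 0 < 2 * t ^ 2 * ∑ i, w i ^ 2 := by positivity
    linarith
  have hw0' := (Finset.sum_eq_zero_iff_of_nonneg fun i _ => sq_nonneg (w i)).1
    (le_antisymm hw0 (Finset.sum_nonneg fun i _ => sq_nonneg (w i)))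
  ext i
  simpa using hw0' i (Finset.mem_univ i)

/-- Otherwise each `w` in `W` has one common signed value on all active coordinates. By extremality
some `w` has a nonzero one, made negative by a change of sign, and moving along this `w` shrinks all
active coordinates at once, against minimality. -/
lemma exists_active_pair {W : Submodule ℝ (Fin n → ℝ)} (hW : W ≠ ⊥) {y : Fin n → ℝ} {d : ℝ}
    (hd : 0 < d) (hy : ‖y‖ = d) (hmin : ∀ w ∈ W, d ≤ ‖y + w‖)
    (hext : ∀ w ∈ W, (∀ i, |y i| = d → w i = 0) → w = 0) :
    ∃ (i j : Fin n) (s t : ℤ), (s = 1 ∨ s = -1) ∧ (t = 1 ∨ t = -1) ∧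
      (s : ℝ) * y i = d ∧ (t : ℝ) * y j = d ∧ ∃ w ∈ W, (s : ℝ) * w i ≠ t * w j := by
  by_contra! hcon
  have hsign : ∀ i, |y i| = d → ∃ s : ℤ, (s = 1 ∨ s = -1) ∧ (s : ℝ) * y i = d := by
    intro i hi
    rcases abs_choice (y i) with h | h
    · exact ⟨1, Or.inl rfl, by rw [← hi, h]; simp⟩
    · exact ⟨-1, Or.inr rfl, by rw [← hi, h]; simp⟩
  obtain ⟨w, hw, i, s, hs, hsy, hneg⟩ : ∃ w ∈ W, ∃ i, ∃ s : ℤ, (s = 1 ∨ s = -1) ∧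
      (s : ℝ) * y i = d ∧ (s : ℝ) * w i < 0 := by
    obtain ⟨w, hw, hw0⟩ := W.exists_mem_ne_zero_of_ne_bot hW
    obtain ⟨i, hi, hwi⟩ : ∃ i, |y i| = d ∧ w i ≠ 0 := by
      by_contra! h
      exact hw0 (hext w hw h)
    obtain ⟨s, hs, hsy⟩ := hsign i hi
    have hs0 : (s : ℝ) ≠ 0 := by rcases hs with rfl | rfl <;> simp
    rcases lt_or_gt_of_ne (mul_ne_zero hs0 hwi) with h | h
    · exact ⟨w, hw, i, s, hs, hsy, h⟩
    · exact ⟨-w, W.neg_mem hw, i, s, hs, hsy, by simpa using h⟩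
  set c := (s : ℝ) * w i with hc
  have hsmall : ∀ᶠ r : ℝ in 𝓝[>] 0, ∀ j, |y j + r * w j| < d := by
    rw [eventually_all]
    intro j
    have hyj : |y j| ≤ d := by rw [← hy]; exact norm_le_pi_norm y j
    rcases hyj.eq_or_lt with h | h
    · obtain ⟨t, ht, hty⟩ := hsign j h
      have hcw : (t : ℝ) * w j = c := (hcon i j s t hs ht hsy hty w hw).symm
      have habs : ∀ r : ℝ, |y j + r * w j| = |d + r * c| := fun r => by
        have : d + r * c = t * (y j + r * w j) := by rw [← hcw, ← hty]; ring
        rw [this, abs_mul]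
        rcases ht with rfl | rfl <;> simp
      have h1 : ∀ᶠ r : ℝ in 𝓝[>] 0, 0 < d + r * c := by
        have : Continuous fun r : ℝ => d + r * c := by fun_prop
        have := (this.tendsto 0).mono_left (nhdsWithin_le_nhds (s := Set.Ioi 0))
        exact this.eventually_const_lt (by simpa using hd)
      filter_upwards [h1, self_mem_nhdsWithin] with r hr hr0
      rw [habs, abs_of_pos hr]
      have := mul_neg_of_pos_of_neg (Set.mem_Ioi.1 hr0) hneg
      linarith
    · have : Continuous fun t : ℝ => |y j + t * w j| := by fun_prop
      have := (this.tendsto 0).mono_left (nhdsWithin_le_nhds (s := Set.Ioi 0))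
      exact this.eventually_lt_const (by simpa using h)
  obtain ⟨r, hr⟩ := hsmall.exists
  have h1 := hmin (r • w) (W.smul_mem r hw)
  have h2 : ‖y + r • w‖ < d := (pi_norm_lt_iff hd).2 fun j => by simpa using hr j
  linarith

/-- The vector of the linear form `s x_i - t x_j`. -/
def pairVec (i j : Fin n) (s t : ℤ) : Fin n → ℤ := Pi.single i s - Pi.single j t

lemma dot_single (i : Fin n) (s : ℤ) (w : Fin n → ℝ) : dot (Pi.single i s) w = s * w i := by
  rw [dot_apply, Finset.sum_eq_single i] <;> simp +contextual

lemma chr_single (i : Fin n) (s : ℤ) (x : Torus n) : chr (Pi.single i s) x = s • x i := by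
  rw [chr_apply, Finset.sum_eq_single i] <;> simp +contextual

lemma dot_sub (a b : Fin n → ℤ) (w : Fin n → ℝ) : dot (a - b) w = dot a w - dot b w := by
  simp [dot_apply, sub_mul, Finset.sum_sub_distrib]

lemma dot_pairVec (i j : Fin n) (s t : ℤ) (w : Fin n → ℝ) :
    dot (pairVec i j s t) w = s * w i - t * w j := by
  rw [pairVec, dot_sub, dot_single, dot_single]

lemma chr_pairVec (i j : Fin n) (s t : ℤ) (x : Torus n) :
    chr (pairVec i j s t) x = s • x i - t • x j := by
  rw [pairVec, sub_eq_add_neg, chr_add, chr_neg, chr_single, chr_single, sub_eq_add_neg]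

lemma sign_smul_half {s : ℤ} (hs : s = 1 ∨ s = -1) :
    s • ((1 / 2 : ℝ) : UnitAddCircle) = ((1 / 2 : ℝ) : UnitAddCircle) := by
  rcases hs with rfl | rfl
  · simp
  · rw [← sub_eq_zero, ← AddCircle.coe_zsmul, ← AddCircle.coe_sub, AddCircle.coe_eq_zero_iff]
    exact ⟨-1, by norm_num⟩

lemma dist_half_sign_smul {s : ℤ} (hs : s = 1 ∨ s = -1) (x : UnitAddCircle) :
    dist ((1 / 2 : ℝ) : UnitAddCircle) (s • x) = dist ((1 / 2 : ℝ) : UnitAddCircle) x := by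
  rw [← sign_smul_half hs, dist_eq_norm, ← smul_sub]
  rcases hs with rfl | rfl
  · simp [dist_eq_norm]
  · rw [sign_smul_half (Or.inr rfl), neg_one_smul, norm_neg, dist_eq_norm]

/-- At an extreme minimizer, two of the active coordinates agree up to sign. -/
lemma exists_pairVec {W : Submodule ℝ (Fin n → ℝ)} (hW : W ≠ ⊥) {y : Fin n → ℝ} {d : ℝ}
    (hd : 0 < d) (hy : ‖y‖ = d) (hmin : ∀ w ∈ W, d ≤ ‖y + w‖)
    (hext : ∀ w ∈ W, (∀ i, |y i| = d → w i = 0) → w = 0) :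
    ∃ (i j : Fin n) (s t : ℤ), i ≠ j ∧ (s = 1 ∨ s = -1) ∧ (t = 1 ∨ t = -1) ∧
      (∃ w ∈ W, dot (pairVec i j s t) w ≠ 0) ∧
      chr (pairVec i j s t) (center n + proj n y) = 0 := by
  obtain ⟨i, j, s, t, hs, ht, hsy, hty, w, hw, hne⟩ := exists_active_pair hW hd hy hmin hext
  refine ⟨i, j, s, t, ?_, hs, ht, ⟨w, hw, ?_⟩, ?_⟩
  · rintro rfl
    have hyi : y i ≠ 0 := by
      rintro h; rw [h, mul_zero] at hsy; exact hd.ne hsy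
    have : (s : ℝ) = t := mul_right_cancel₀ hyi (hsy.trans hty.symm)
    exact hne (by rw [this])
  · rw [dot_pairVec]; exact sub_ne_zero.2 hne
  · rw [map_add, chr_proj, dot_pairVec, hsy, hty, sub_self, AddCircle.coe_zero, add_zero,
      chr_pairVec, center_apply, center_apply, sign_smul_half hs, sign_smul_half ht, sub_self]

lemma IsTangent.add_proj_mem {W : Submodule ℝ (Fin n → ℝ)} {Δ : AddSubgroup (Torus n)}
    (h : IsTangent W Δ) {x : Torus n} (hx : x ∈ Δ) {w : Fin n → ℝ} (hw : w ∈ W) :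
    x + proj n w ∈ Δ :=
  Δ.add_mem hx (h.le ⟨w, hw, rfl⟩)

lemma IsTangent.D_le_norm {W : Submodule ℝ (Fin n → ℝ)} {Δ : AddSubgroup (Torus n)}
    (h : IsTangent W Δ) {y : Fin n → ℝ} (hy : center n + proj n y ∈ Δ) {w : Fin n → ℝ}
    (hw : w ∈ W) : D (Δ : Set (Torus n)) ≤ ‖y + w‖ := by
  have := h.add_proj_mem hy hw
  rw [add_assoc, ← map_add] at this
  exact (D_le_dist this).trans (dist_center_add_proj_le _)

/-- A subgroup of positive dimension can be cut by the kernel of a character without changing its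
distance to the center, in such a way that moreover one of the coordinates becomes irrelevant. -/
theorem IsTangent.exists_cut {W : Submodule ℝ (Fin n → ℝ)} {Δ : AddSubgroup (Torus n)}
    (h : IsTangent W Δ) (hW : W ≠ ⊥) :
    ∃ (a : Fin n → ℤ) (j : Fin n), a j ≠ 0 ∧ (∃ w ∈ W, dot a w ≠ 0) ∧
      (∃ x ∈ Δ, chr a x = 0 ∧ dist (center n) x = D (Δ : Set (Torus n))) ∧
      ∀ x ∈ Δ, chr a x = 0 → ∀ r ≥ 0, (∀ l, l ≠ j → dist (center n l) (x l) ≤ r) →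
        D (Δ : Set (Torus n)) ≤ r := by
  obtain ⟨x, hx, hxd⟩ := h.exists_dist_eq
  -- If the distance is 0, the nearest point is the center, where `2 x_j` vanishes, and the last
  -- clause is just `0 ≤ r`.
  rcases (D_nonneg (Δ : Set (Torus n))).eq_or_lt with h0 | hpos
  · obtain ⟨w, hw, hw0⟩ := W.exists_mem_ne_zero_of_ne_bot hW
    obtain ⟨j, hj⟩ := Function.ne_iff.1 hw0
    rw [← h0, dist_eq_zero] at hxd
    subst hxd
    refine ⟨Pi.single j 2, j, by simp, ⟨w, hw, ?_⟩, ⟨_, hx, ?_, by rw [dist_self, ← h0]⟩, ?_⟩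
    · rw [dot_single]; simpa using hj
    · rw [chr_single, center_apply, ← AddCircle.coe_zsmul, AddCircle.coe_eq_zero_iff]
      exact ⟨1, by norm_num⟩
    · intro _ _ _ r hr _
      rw [← h0]; exact hr
  · obtain ⟨y, rfl, hy⟩ := exists_lift x
    have hyn := norm_lift hy
    rw [hxd] at hyn
    obtain ⟨w₀, hw₀, hn, hext⟩ := exists_extreme W hyn fun w hw => h.D_le_norm hx hw
    have hmem : center n + proj n (y + w₀) ∈ Δ := by
      rw [map_add, ← add_assoc]; exact h.add_proj_mem hx hw₀
    obtain ⟨i, j, s, t, hij, hs, ht, hne, hchr⟩ := exists_pairVec hW hpos hn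
      (fun w hw => h.D_le_norm hmem hw) hext
    refine ⟨pairVec i j s t, j, ?_, hne, ⟨_, hmem, hchr, ?_⟩, ?_⟩
    · have : t ≠ 0 := by rcases ht with rfl | rfl <;> simp
      simpa [pairVec, hij] using this
    · exact le_antisymm ((dist_center_add_proj_le _).trans hn.le) (D_le_dist hmem)
    · intro x hx hx0 r hr hl
      refine (D_le_dist hx).trans ((dist_pi_le_iff hr).2 fun l => ?_)
      by_cases hlj : l = j
      · subst hlj
        -- On the kernel `s x_i = t x_j`, and signs preserve the distance to 1/2, so the coordinate
        -- `j` repeats the constraint of `i`.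
        rw [chr_pairVec, sub_eq_zero] at hx0
        have := hl i hij
        rwa [center_apply, ← dist_half_sign_smul hs, hx0, dist_half_sign_smul ht] at this
      · exact hl l hlj

/-! ### Spectra of subgroups -/

lemma mem_properSubgroups_iff {k : ℕ} {Δ : AddSubgroup (Torus n)} :
    Δ ∈ properSubgroups k n ↔ (∃ W, IsTangent W Δ ∧ Module.finrank ℝ W = k) ∧
      D (Δ : Set (Torus n)) < 1 / 2 := by
  rw [properSubgroups, Set.mem_ofPred_eq, isSubgroupOfDim_iff, isProper_iff_D_lt]

lemma mem_SStar_iff {k : ℕ} {d : ℝ} :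
    d ∈ SStar k n ↔ d < 1 / 2 ∧ ∃ (Δ : AddSubgroup (Torus n)) (W : Submodule ℝ (Fin n → ℝ)),
      IsTangent W Δ ∧ Module.finrank ℝ W = k ∧ D (Δ : Set (Torus n)) = d := by
  constructor
  · rintro ⟨Δ, hΔ, rfl⟩
    obtain ⟨⟨W, hW, hk⟩, hlt⟩ := mem_properSubgroups_iff.1 hΔ
    exact ⟨hlt, Δ, W, hW, hk, rfl⟩
  · rintro ⟨hlt, Δ, W, hW, hk, rfl⟩
    exact ⟨Δ, mem_properSubgroups_iff.2 ⟨⟨W, hW, hk⟩, hlt⟩, rfl⟩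

lemma mem_properSubtori_iff {k : ℕ} {T : AddSubgroup (Torus n)} :
    T ∈ properSubtori k n ↔ (∃ W, IsRational W ∧ Module.finrank ℝ W = k ∧ T = torusOf W) ∧
      D (T : Set (Torus n)) < 1 / 2 := by
  rw [properSubtori, Set.mem_ofPred_eq, isProper_iff_D_lt]
  rfl

lemma mem_S_iff {k : ℕ} {d : ℝ} :
    d ∈ S k n ↔ d < 1 / 2 ∧ ∃ W : Submodule ℝ (Fin n → ℝ),
      IsRational W ∧ Module.finrank ℝ W = k ∧ D (torusOf W : Set (Torus n)) = d := by
  constructor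
  · rintro ⟨T, hT, rfl⟩
    obtain ⟨⟨W, hW, hk, rfl⟩, hlt⟩ := mem_properSubtori_iff.1 hT
    exact ⟨hlt, W, hW, hk, rfl⟩
  · rintro ⟨hlt, W, hW, hk, rfl⟩
    exact ⟨_, mem_properSubtori_iff.2 ⟨⟨W, hW, hk, rfl⟩, hlt⟩, rfl⟩

lemma S_subset_SStar (k : ℕ) : S k n ⊆ SStar k n := by
  intro d hd
  obtain ⟨hlt, W, hW, hk, rfl⟩ := mem_S_iff.1 hd
  exact mem_SStar_iff.2 ⟨hlt, _, W, isTangent_torusOf hW, hk, rfl⟩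

lemma ne_bot_of_finrank {W : Submodule ℝ (Fin n → ℝ)} {k : ℕ}
    (h : Module.finrank ℝ W = k + 1) : W ≠ ⊥ := by
  rintro rfl
  simp at h

lemma D_inf_ker {Δ : AddSubgroup (Torus n)} {a : Fin n → ℤ}
    (h : ∃ x ∈ Δ, chr a x = 0 ∧ dist (center n) x = D (Δ : Set (Torus n))) :
    D ((Δ ⊓ (chr a).ker : AddSubgroup (Torus n)) : Set (Torus n)) = D (Δ : Set (Torus n)) := by
  obtain ⟨x, hx, hx0, hd⟩ := h
  refine le_antisymm ?_ (D_anti inf_le_left)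
  rw [← hd]
  exact D_le_dist ⟨hx, hx0⟩

lemma SStar_succ_subset (k : ℕ) : SStar (k + 1) n ⊆ SStar k n := by
  intro d hd
  obtain ⟨hlt, Δ, W, hW, hk, rfl⟩ := mem_SStar_iff.1 hd
  obtain ⟨a, -, -, hne, hx, -⟩ := hW.exists_cut (ne_bot_of_finrank hk)
  refine mem_SStar_iff.2 ⟨hlt, _, _, hW.inf_ker a, ?_, D_inf_ker hx⟩
  have := finrank_slice hne
  omega

lemma SStar_subset_of_le {j k : ℕ} (h : k ≤ j) : SStar j n ⊆ SStar k n :=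
  Nat.le_induction (P := fun j _ => SStar j n ⊆ SStar k n) subset_rfl
    (fun j _ ih => (SStar_succ_subset j).trans ih) j h

/-! ### Deleting and adding a coordinate -/

/-- Deletion of the `j`-th coordinate on the torus. -/
def del {m : ℕ} (j : Fin (m + 1)) : Torus (m + 1) →+ Torus m where
  toFun x l := x (j.succAbove l)
  map_zero' := rfl
  map_add' _ _ := rfl

/-- Deletion of the `j`-th coordinate on `ℝ^(m+1)`. -/
def realDel {m : ℕ} (j : Fin (m + 1)) : (Fin (m + 1) → ℝ) →ₗ[ℝ] (Fin m → ℝ) :=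
  LinearMap.funLeft ℝ ℝ j.succAbove

/-- Insertion of a zero as first coordinate. -/
def consZero (m : ℕ) : (Fin m → ℝ) →ₗ[ℝ] (Fin (m + 1) → ℝ) where
  toFun v := Fin.cons 0 v
  map_add' v w := by ext i; refine Fin.cases ?_ (fun i => ?_) i <;> simp
  map_smul' c v := by ext i; refine Fin.cases ?_ (fun i => ?_) i <;> simp

section Delete

variable {m : ℕ} (j : Fin (m + 1))

@[simp] lemma realDel_apply (v : Fin (m + 1) → ℝ) (l : Fin m) :
    realDel j v l = v (j.succAbove l) := rfl

@[simp] lemma del_apply (x : Torus (m + 1)) (l : Fin m) : del j x l = x (j.succAbove l) := rfl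

lemma torusOf_map_realDel (W : Submodule ℝ (Fin (m + 1) → ℝ)) :
    torusOf (W.map (realDel j)) = (torusOf W).map (del j) := by
  ext x
  constructor
  · rintro ⟨_, ⟨w, hw, rfl⟩, rfl⟩
    exact ⟨_, ⟨w, hw, rfl⟩, rfl⟩
  · rintro ⟨_, ⟨w, hw, rfl⟩, rfl⟩
    exact ⟨_, ⟨w, hw, rfl⟩, rfl⟩

lemma IsRational.map_realDel {W : Submodule ℝ (Fin (m + 1) → ℝ)} (hW : IsRational W) :
    IsRational (W.map (realDel j)) := by
  rw [← hW, Submodule.map_span]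
  refine isRational_span ?_
  rintro _ ⟨v, ⟨-, hv⟩, rfl⟩ l
  exact hv _

lemma IsTangent.map_del {W : Submodule ℝ (Fin (m + 1) → ℝ)} {Δ : AddSubgroup (Torus (m + 1))}
    (h : IsTangent W Δ) : IsTangent (W.map (realDel j)) (Δ.map (del j)) := by
  refine ⟨h.isRational.map_realDel j, ?_, ?_⟩
  · rw [torusOf_map_realDel]; exact AddSubgroup.map_mono h.le
  · rw [torusOf_map_realDel, AddSubgroup.relIndex_map_map]
    have e : Δ ⊔ (del j).ker = Δ ⊔ (torusOf W ⊔ (del j).ker) := by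
      rw [← sup_assoc, sup_eq_left.2 h.le]
    rw [e, AddSubgroup.relIndex_sup_right]
    intro h0
    exact h.relIndex_ne_zero (AddSubgroup.relIndex_eq_zero_of_le_left le_sup_left h0)

/-- Since `a j ≠ 0`, the equation `a(w) = 0` recovers the deleted coordinate from the others. -/
lemma finrank_map_realDel {W : Submodule ℝ (Fin (m + 1) → ℝ)} {a : Fin (m + 1) → ℤ}
    (ha : a j ≠ 0) :
    Module.finrank ℝ ((slice W a).map (realDel j)) = Module.finrank ℝ (slice W a) := by
  rw [← LinearMap.range_domRestrict]
  refine LinearMap.finrank_range_of_inj ?_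
  rw [← LinearMap.ker_eq_bot, LinearMap.ker_eq_bot']
  rintro ⟨w, hw, hw'⟩ h0
  have hl : ∀ l, w (j.succAbove l) = 0 := fun l => congrFun h0 l
  have hdot : dot a w = 0 := hw'
  rw [dot_apply, Fin.sum_univ_succAbove _ j] at hdot
  simp only [hl, mul_zero, Finset.sum_const_zero, add_zero, mul_eq_zero, Int.cast_eq_zero, ha,
    false_or] at hdot
  refine Subtype.ext (funext fun l => ?_)
  rcases Fin.eq_self_or_eq_succAbove j l with rfl | ⟨l, rfl⟩
  · exact hdot
  · exact hl l

lemma SStar_succ_succ_subset (k : ℕ) : SStar (k + 1) (m + 1) ⊆ SStar k m := by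
  intro d hd
  obtain ⟨hlt, Δ, W, hW, hk, rfl⟩ := mem_SStar_iff.1 hd
  obtain ⟨a, j, haj, hne, hx, hirr⟩ := hW.exists_cut (ne_bot_of_finrank hk)
  refine mem_SStar_iff.2 ⟨hlt, _, _, (hW.inf_ker a).map_del j, ?_, le_antisymm ?_ ?_⟩
  · have := finrank_slice hne
    rw [finrank_map_realDel j haj]
    omega
  · obtain ⟨x, hx, hx0, hd⟩ := hx
    rw [← hd]
    have : del j x ∈ (Δ ⊓ (chr a).ker).map (del j) := ⟨x, ⟨hx, hx0⟩, rfl⟩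
    refine (D_le_dist this).trans ((dist_pi_le_iff dist_nonneg).2 fun l => ?_)
    exact dist_le_pi_dist (center (m + 1)) x (j.succAbove l)
  · refine (Metric.le_infDist ⟨0, AddSubgroup.zero_mem _⟩).2 ?_
    rintro _ ⟨x, ⟨hx, hx0⟩, rfl⟩
    refine hirr x hx hx0 _ dist_nonneg fun l hl => ?_
    obtain ⟨l, rfl⟩ := Fin.exists_succAbove_eq hl
    exact dist_le_pi_dist (center m) (del j x) l

lemma torusOf_comap_realDel (W : Submodule ℝ (Fin m → ℝ)) :
    torusOf (W.comap (realDel j)) = (torusOf W).comap (del j) := by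
  ext x
  constructor
  · rintro ⟨w, hw, rfl⟩
    exact ⟨_, hw, rfl⟩
  · rintro ⟨w, hw, hwx⟩
    obtain ⟨u, hu⟩ := QuotientAddGroup.mk_surjective (x j)
    refine ⟨j.insertNth u w, ?_, ?_⟩
    · change realDel j (j.insertNth u w) ∈ W
      have : realDel j (j.insertNth u w) = w := by ext l; simp
      rw [this]; exact hw
    · ext l
      rcases Fin.eq_self_or_eq_succAbove j l with rfl | ⟨l, rfl⟩
      · rw [proj_apply, Fin.insertNth_apply_same]; exact hu
      · rw [proj_apply, Fin.insertNth_apply_succAbove]; exact congrFun hwx l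

lemma realDel_consZero (v : Fin m → ℝ) : realDel 0 (consZero m v) = v := by
  ext l; simp [consZero]

lemma consZero_realDel_add (v : Fin (m + 1) → ℝ) :
    v = v 0 • Pi.single 0 1 + consZero m (realDel 0 v) := by
  ext l
  refine Fin.cases ?_ (fun l => ?_) l <;> simp [consZero]

lemma IsRational.comap_realDel {W : Submodule ℝ (Fin m → ℝ)} (hW : IsRational W) :
    IsRational (W.comap (realDel 0)) := by
  refine isRational_of_le_span ?_
  set J := Submodule.span ℝ ((W.comap (realDel 0) : Set (Fin (m + 1) → ℝ)) ∩ intVectors (m + 1))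
  have h1 : (Pi.single 0 1 : Fin (m + 1) → ℝ) ∈ J := by
    refine Submodule.subset_span ⟨?_, fun i => ?_⟩
    · have : realDel 0 (Pi.single 0 1 : Fin (m + 1) → ℝ) = 0 := by ext l; simp
      change realDel 0 _ ∈ W
      rw [this]; exact W.zero_mem
    · refine Fin.cases ⟨1, by simp⟩ (fun l => ⟨0, by simp⟩) i
  have h2 : W ≤ J.comap (consZero m) := by
    rw [← hW, Submodule.span_le]
    rintro v ⟨hv, hv'⟩
    refine Submodule.subset_span ⟨?_, fun i => ?_⟩
    · change realDel 0 _ ∈ W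
      rw [realDel_consZero]; exact hv
    · exact Fin.cases ⟨0, by simp [consZero]⟩ (fun l => by simpa [consZero] using hv' l) i
  intro v hv
  rw [consZero_realDel_add v]
  exact J.add_mem (J.smul_mem _ h1) (h2 hv)

lemma IsTangent.comap_del {W : Submodule ℝ (Fin m → ℝ)} {Δ : AddSubgroup (Torus m)}
    (h : IsTangent W Δ) : IsTangent (W.comap (realDel 0)) (Δ.comap (del 0)) := by
  refine ⟨h.isRational.comap_realDel, ?_, ?_⟩
  · rw [torusOf_comap_realDel]; exact AddSubgroup.comap_mono h.le
  · rw [torusOf_comap_realDel]; exact AddSubgroup.relIndex_comap_ne_zero _ h.relIndex_ne_zero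

/-- Inserting a zero identifies `W` with the hyperplane `x_0 = 0` of the preimage. -/
lemma finrank_comap_realDel (W : Submodule ℝ (Fin m → ℝ)) :
    Module.finrank ℝ (W.comap (realDel 0)) = Module.finrank ℝ W + 1 := by
  have hinj : Function.Injective (consZero m) := fun v w h => by
    rw [← realDel_consZero v, h, realDel_consZero]
  have hmap : W.map (consZero m) = slice (W.comap (realDel 0)) (Pi.single 0 1) := by
    ext v
    constructor
    · rintro ⟨w, hw, rfl⟩
      refine ⟨?_, ?_⟩
      · change realDel 0 _ ∈ W
        rw [realDel_consZero]; exact hw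
      · simp [dot_single, consZero]
    · rintro ⟨h1, h2⟩
      refine ⟨realDel 0 v, h1, ?_⟩
      have h3 : dot (Pi.single 0 1) v = 0 := h2
      rw [dot_single] at h3
      have h4 : v 0 = 0 := by simpa using h3
      conv_rhs => rw [consZero_realDel_add v, h4, zero_smul, zero_add]
  rw [(Submodule.equivMapOfInjective _ hinj W).finrank_eq, hmap, finrank_slice]
  refine ⟨Pi.single 0 1, ?_, by simp [dot_single]⟩
  have : realDel 0 (Pi.single 0 1 : Fin (m + 1) → ℝ) = 0 := by ext l; simp
  change realDel 0 _ ∈ W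
  rw [this]; exact W.zero_mem

/-- The free coordinate can be set to 1/2 at no cost. -/
lemma D_comap_del (Δ : AddSubgroup (Torus m)) :
    D ((Δ.comap (del 0) : AddSubgroup (Torus (m + 1))) : Set (Torus (m + 1)))
      = D (Δ : Set (Torus m)) := by
  refine le_antisymm ((Metric.le_infDist ⟨0, Δ.zero_mem⟩).2 fun x hx => ?_)
    ((Metric.le_infDist ⟨0, AddSubgroup.zero_mem _⟩).2 fun x hx => ?_)
  · let x' : Torus (m + 1) := Fin.cons (center (m + 1) 0) x
    have hx' : x' ∈ Δ.comap (del 0) := by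
      have : del 0 x' = x := by ext l; simp [x']
      rw [AddSubgroup.mem_comap, this]; exact hx
    refine (D_le_dist hx').trans ((dist_pi_le_iff dist_nonneg).2 fun l => ?_)
    refine Fin.cases ?_ (fun l => ?_) l
    · simp [x']
    · exact dist_le_pi_dist (center m) x l
  · refine (D_le_dist (Δ := Δ) hx).trans ((dist_pi_le_iff dist_nonneg).2 fun l => ?_)
    exact dist_le_pi_dist (center (m + 1)) x (Fin.succAbove 0 l)

theorem SStar_succ_succ (k m : ℕ) : SStar (k + 1) (m + 1) = SStar k m := by
  refine (SStar_succ_succ_subset k).antisymm fun d hd => ?_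
  obtain ⟨hlt, Δ, W, hW, hk, rfl⟩ := mem_SStar_iff.1 hd
  exact mem_SStar_iff.2 ⟨hlt, _, _, hW.comap_del, by rw [finrank_comap_realDel, hk], D_comap_del Δ⟩

theorem SStar_add (k m : ℕ) : SStar k (m + k) = SStar 0 m := by
  induction k with
  | zero => rfl
  | succ k ih => rw [← ih, ← add_assoc, SStar_succ_succ]

end Delete

/-! ### Spectra of subtori -/

/-- Cutting without changing `D` leads down to dimension 0, where the group is finite. -/
lemma IsTangent.exists_torsion_dist_eq {k : ℕ} {W : Submodule ℝ (Fin n → ℝ)}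
    {Δ : AddSubgroup (Torus n)} (h : IsTangent W Δ) (hk : Module.finrank ℝ W = k) :
    ∃ x ∈ Δ, dist (center n) x = D (Δ : Set (Torus n)) ∧ ∃ N : ℕ, 0 < N ∧ N • x = 0 := by
  induction k generalizing W Δ with
  | zero =>
    obtain ⟨x, hx, hd⟩ := h.exists_dist_eq
    refine ⟨x, hx, hd, ?_⟩
    obtain ⟨N, hN, -, hmem⟩ :=
      AddSubgroup.exists_nsmul_mem_of_relIndex_ne_zero h.relIndex_ne_zero hx
    refine ⟨N, hN, ?_⟩
    obtain ⟨w, hw, hwN⟩ := hmem.1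
    have : W = ⊥ := Submodule.finrank_eq_zero.1 hk
    subst this
    rw [← hwN, (Submodule.mem_bot ℝ).1 hw, map_zero]
  | succ k ih =>
    obtain ⟨a, -, -, hne, hx, -⟩ := h.exists_cut (ne_bot_of_finrank hk)
    have hr := finrank_slice hne
    obtain ⟨x, hx', hd, hN⟩ := ih (h.inf_ker a) (by omega)
    exact ⟨x, hx'.1, by rw [hd, D_inf_ker hx], hN⟩

/-- Gram–Schmidt with cleared denominators: `a = p u - q z` is the part orthogonal to `z` of an
integer vector `u` of `W` not proportional to `z`. -/
lemma IsRational.exists_orthogonal {W : Submodule ℝ (Fin n → ℝ)} (hW : IsRational W)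
    (h2 : 2 ≤ Module.finrank ℝ W) (z : Fin n → ℤ) :
    ∃ a : Fin n → ℤ, dot a (toReal z) = 0 ∧ ∃ w ∈ W, dot a w ≠ 0 := by
  obtain ⟨u, hu, huz⟩ : ∃ u : Fin n → ℤ, toReal u ∈ W ∧ toReal u ∉ Submodule.span ℝ {toReal z} := by
    by_contra! hcon
    have : W ≤ Submodule.span ℝ {toReal z} := by
      rw [← hW, Submodule.span_le]
      rintro v ⟨hv, hv'⟩
      obtain ⟨u, rfl⟩ := exists_eq_toReal hv'
      exact hcon u hv
    have h1 := (Submodule.finrank_mono this).trans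
      (finrank_span_le_card ({toReal z} : Set (Fin n → ℝ)))
    rw [Set.toFinset_singleton, Finset.card_singleton] at h1
    omega
  by_cases hz : z = 0
  · subst hz
    refine ⟨u, by simp [dot_apply, toReal], toReal u, hu, ?_⟩
    intro h0
    apply huz
    have : ∑ i, toReal u i * toReal u i = 0 := by rw [← h0, dot_apply]; rfl
    rw [Finset.sum_eq_zero_iff_of_nonneg fun i _ => mul_self_nonneg _] at this
    have hu0 : toReal u = 0 := by ext i; simpa using this i (Finset.mem_univ i)
    rw [hu0]; exact Submodule.zero_mem _
  · set p : ℤ := ∑ i, z i * z i with hp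
    set q : ℤ := ∑ i, z i * u i with hq
    have hp0 : p ≠ 0 := by
      intro h0
      rw [hp, Finset.sum_eq_zero_iff_of_nonneg fun i _ => mul_self_nonneg _] at h0
      exact hz (funext fun i => by simpa using h0 i (Finset.mem_univ i))
    let a : Fin n → ℤ := fun i => p * u i - q * z i
    have haz : dot a (toReal z) = 0 := by
      rw [dot_toReal]
      norm_cast
      have : ∑ i, a i * z i = p * ∑ i, z i * u i - q * ∑ i, z i * z i := by
        rw [Finset.mul_sum, Finset.mul_sum, ← Finset.sum_sub_distrib]
        exact Finset.sum_congr rfl fun i _ => by simp only [a]; ring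
      rw [this, ← hp, ← hq]; ring
    refine ⟨a, haz, toReal u, hu, fun hau => huz ?_⟩
    have ha' : toReal a = (p : ℝ) • toReal u - (q : ℝ) • toReal z := by
      ext i; simp [toReal, a]
    have haa : dot a (toReal a) = 0 := by rw [ha', map_sub, map_smul, map_smul, hau, haz]; simp
    have : ∑ i, toReal a i * toReal a i = 0 := by rw [← haa, dot_apply]; rfl
    rw [Finset.sum_eq_zero_iff_of_nonneg fun i _ => mul_self_nonneg _] at this
    have ha0 : toReal a = 0 := by ext i; simpa using this i (Finset.mem_univ i)
    rw [ha0, eq_comm, sub_eq_zero] at ha'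
    have hmem : (p : ℝ) • toReal u ∈ Submodule.span ℝ {toReal z} := by
      rw [ha']; exact Submodule.smul_mem _ _ (Submodule.mem_span_singleton_self _)
    exact (Submodule.smul_mem_iff _ (by exact_mod_cast hp0)).1 hmem

/-- The kernel of a character need not be a torus, so the slice is taken upstairs. A torsion nearest
point has a lift `w` with an integer multiple `z`, and a form vanishing on `z` vanishes on `w`.
Finding such a form that is nonzero on `W` requires dimension at least 2. -/
lemma S_succ_succ_subset (k : ℕ) : S (k + 2) n ⊆ S (k + 1) n := by
  intro d hd
  obtain ⟨hlt, W, hW, hk, rfl⟩ := mem_S_iff.1 hd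
  obtain ⟨_, ⟨w, hw, rfl⟩, hd, N, hN, hNx⟩ := (isTangent_torusOf hW).exists_torsion_dist_eq hk
  rw [← map_nsmul, proj_eq_zero_iff, ← Nat.cast_smul_eq_nsmul ℝ] at hNx
  obtain ⟨z, hz⟩ := exists_eq_toReal hNx
  obtain ⟨a, haz, hne⟩ := hW.exists_orthogonal (by omega) z
  have haw : dot a w = 0 := by
    rw [← hz, map_smul, smul_eq_mul, mul_eq_zero] at haz
    exact haz.resolve_left (by positivity)
  have hr := finrank_slice hne
  refine mem_S_iff.2 ⟨hlt, slice W a, hW.slice a, by omega, le_antisymm ?_ ?_⟩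
  · rw [← hd]
    exact D_le_dist ⟨w, ⟨hw, haw⟩, rfl⟩
  · exact D_anti (AddSubgroup.map_mono (Submodule.toAddSubgroup_mono inf_le_left))

lemma S_subset_of_le {j k : ℕ} (h : k ≤ j) : S (j + 1) n ⊆ S (k + 1) n :=
  Nat.le_induction (P := fun j _ => S (j + 1) n ⊆ S (k + 1) n) subset_rfl
    (fun j _ ih => (S_succ_succ_subset j).trans ih) j h

/-! ### Density points of the spectra -/

/-- If `W` had dimension at most `k`, the tangent spaces would eventually equal `W`, and `U` would
concentrate on the finite set of subgroups between the torus of `W` and `Δ'`. -/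
lemma finrank_lt_of_limit {U : Ultrafilter (AddSubgroup (Torus n))}
    (hU : (U : Filter (AddSubgroup (Torus n))) ≤ cofinite) {k : ℕ}
    (hk : ∀ᶠ Δ in (U : Filter (AddSubgroup (Torus n))),
      ∃ V, IsTangent V Δ ∧ Module.finrank ℝ V = k)
    {Δ' : AddSubgroup (Torus n)} {W : Submodule ℝ (Fin n → ℝ)} (hW : IsTangent W Δ')
    (hle : ∀ᶠ Δ in (U : Filter (AddSubgroup (Torus n))), Δ ≤ Δ') :
    k < Module.finrank ℝ W := by
  by_contra! hcon
  have hfin := hU hW.finite_between.compl_mem_cofinite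
  obtain ⟨Δ, ⟨V, hV, hVk⟩, hΔ, hnot⟩ := (hk.and (hle.and hfin)).exists
  have hVW : V ≤ W := hW.le_of_torusOf_le (hV.le.trans hΔ)
  have : V = W := Submodule.eq_of_le_of_finrank_le hVW (by omega)
  subst this
  exact hnot ⟨hV.le, hΔ⟩

lemma den_SStarMult_subset (k : ℕ) : den (SStarMult k n) ⊆ SStar (k + 1) n := by
  intro x hx
  obtain ⟨U, hU, hP, ht⟩ := exists_ultrafilter ((mem_den_iff (properSubgroups k n)
    (fun Δ : AddSubgroup (Torus n) => D (Δ : Set (Torus n))) x).1 hx)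
  obtain ⟨Δ', W, hW, hle, hnear⟩ := exists_limit U id
  have hD : D (Δ' : Set (Torus n)) = x := tendsto_nhds_unique (tendsto_D_of_limit hle hnear) ht
  have hlt : x < 1 / 2 := by
    obtain ⟨Δ, h1, h2⟩ := (hle.and hP).exists
    rw [← hD]
    exact (D_anti h1).trans_lt (mem_properSubgroups_iff.1 h2).2
  have hrank := finrank_lt_of_limit hU (hP.mono fun Δ h => (mem_properSubgroups_iff.1 h).1) hW hle
  exact SStar_subset_of_le hrank (mem_SStar_iff.2 ⟨hlt, Δ', W, hW, rfl, hD⟩)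

lemma den_SMult_subset (k : ℕ) : den (SMult k n) ⊆ S (k + 1) n := by
  intro x hx
  obtain ⟨U, hU, hP, ht⟩ := exists_ultrafilter ((mem_den_iff (properSubtori k n)
    (fun Δ : AddSubgroup (Torus n) => D (Δ : Set (Torus n))) x).1 hx)
  obtain ⟨Δ', W, hW, hle, hnear⟩ := exists_limit U id
  have hD : D (Δ' : Set (Torus n)) = x := tendsto_nhds_unique (tendsto_D_of_limit hle hnear) ht
  have hlt : x < 1 / 2 := by
    obtain ⟨Δ, h1, h2⟩ := (hle.and hP).exists
    rw [← hD]
    exact (D_anti h1).trans_lt (mem_properSubtori_iff.1 h2).2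
  have hP' : ∀ᶠ Δ in (U : Filter (AddSubgroup (Torus n))),
      ∃ V, IsRational V ∧ Module.finrank ℝ V = k ∧ Δ = torusOf V :=
    hP.mono fun Δ h => (mem_properSubtori_iff.1 h).1
  have hrank := finrank_lt_of_limit hU (k := k) (hP'.mono fun Δ h => by
    obtain ⟨V, hV, hVk, rfl⟩ := h
    exact ⟨V, isTangent_torusOf hV, hVk⟩) hW hle
  -- The approximating tori have tangent spaces inside `W`, so every point of `Δ'` is a limit of
  -- points of the closed torus of `W`.
  have htorus : Δ' = torusOf W := by
    refine le_antisymm (fun y hy => ?_) hW.le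
    have hcl : y ∈ closure (torusOf W : Set (Torus n)) := by
      rw [Metric.mem_closure_iff]
      intro ε hε
      obtain ⟨Δ, ⟨V, hV, hVk, hΔ⟩, h1, z, hz, hyz⟩ := (hP'.and (hle.and (hnear y hy ε hε))).exists
      refine ⟨z, ?_, hyz⟩
      have hVW : V ≤ W := hW.le_of_torusOf_le (hΔ ▸ h1)
      have hz' : z ∈ torusOf V := hΔ ▸ hz
      exact AddSubgroup.map_mono (Submodule.toAddSubgroup_mono hVW) hz'
    rwa [(isCompact_torusOf hW.isRational).isClosed.closure_eq] at hcl
  obtain ⟨j, hj⟩ : ∃ j, Module.finrank ℝ W = j + 1 := ⟨_, (Nat.succ_pred_eq_of_pos (by omega)).symm⟩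
  refine S_subset_of_le (j := j) (by omega) (mem_S_iff.2 ⟨hlt, W, hW.isRational, hj, ?_⟩)
  rw [← htorus, hD]

/-! ### Approximating a subgroup from inside by subgroups of one dimension less. -/

/-- With only finitely many such subgroups, `Γ` would be constant along a nonprincipal ultrafilter.
That one closed subgroup would then contain `Δ`, against its dimension. -/
lemma infinite_of_near {k : ℕ} {Δ : AddSubgroup (Torus n)} {W : Submodule ℝ (Fin n → ℝ)}
    (h : IsTangent W Δ) (hk : Module.finrank ℝ W = k + 1) {Γ : ℕ → AddSubgroup (Torus n)}
    (hΓ : ∀ m, ∃ V, IsTangent V (Γ m) ∧ Module.finrank ℝ V = k) (hle : ∀ m, Γ m ≤ Δ) {C : ℝ}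
    (hnear : ∀ m : ℕ, ∀ x ∈ Δ, ∃ y ∈ Γ m, dist x y ≤ C / (m + 1)) {ε : ℝ} (hε : 0 < ε) :
    {Δ' | Δ' ∈ Set.range Γ ∧ |D (Δ' : Set (Torus n)) - D (Δ : Set (Torus n))| < ε}.Infinite := by
  have hC : Tendsto (fun m : ℕ => C / ((m : ℝ) + 1)) atTop (𝓝 0) := by
    simpa [div_eq_mul_inv] using
      (tendsto_one_div_add_atTop_nhds_zero_nat (𝕜 := ℝ)).const_mul C
  intro hfin
  have hev : ∀ᶠ m in atTop, Γ m ∈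
      {Δ' | Δ' ∈ Set.range Γ ∧ |D (Δ' : Set (Torus n)) - D (Δ : Set (Torus n))| < ε} := by
    filter_upwards [hC.eventually_lt_const hε] with m hm
    refine ⟨⟨m, rfl⟩, ?_⟩
    have h1 := D_anti (hle m)
    have h2 := D_le_add_of_near (hnear m)
    rw [abs_of_nonneg (by linarith)]
    linarith
  let U : Ultrafilter ℕ := hyperfilter ℕ
  have hU : (U : Filter ℕ) ≤ atTop := Nat.hyperfilter_le_atTop
  obtain ⟨Δ', -, hpure⟩ := (U.map Γ).eq_pure_of_finite_mem hfin (hU hev)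
  have hconst : ∀ᶠ m in (U : Filter ℕ), Γ m = Δ' := by
    have : {Δ'} ∈ U.map Γ := by rw [hpure]; exact Set.mem_singleton _
    exact this
  obtain ⟨m₀, hm₀⟩ := hconst.exists
  obtain ⟨V, hV, hVk⟩ := hΓ m₀
  have hΔ' : Δ ≤ Γ m₀ := by
    intro x hx
    have hcl : x ∈ closure (Γ m₀ : Set (Torus n)) := by
      rw [Metric.mem_closure_iff]
      intro δ hδ
      obtain ⟨m, hm, hlt⟩ := (hconst.and (hU (hC.eventually_lt_const hδ))).exists
      obtain ⟨y, hy, hxy⟩ := hnear m x hx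
      rw [hm, ← hm₀] at hy
      exact ⟨y, hy, hxy.trans_lt hlt⟩
    rwa [hV.isCompact.isClosed.closure_eq] at hcl
  have := Submodule.finrank_mono (hV.le_of_torusOf_le (h.le.trans hΔ'))
  omega

/-- Moving along `w` corrects the value of the character, which has a representative of absolute
value at most 1. -/
lemma exists_near_mem_ker {Δ : AddSubgroup (Torus n)} {W : Submodule ℝ (Fin n → ℝ)}
    (h : IsTangent W Δ) {a : Fin n → ℤ} {w : Fin n → ℝ} (hw : w ∈ W) (haw : dot a w ≠ 0)
    {x : Torus n} (hx : x ∈ Δ) :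
    ∃ y ∈ Δ ⊓ (chr a).ker, dist x y ≤ ‖w‖ / |dot a w| := by
  obtain ⟨t, ht, ht'⟩ := exists_coe_eq_abs_eq (chr a x)
  have ht1 : |t| ≤ 1 := by
    rw [ht']
    have := AddCircle.norm_le_half_period (1 : ℝ) (x := chr a x) one_ne_zero
    norm_num at this
    linarith
  refine ⟨x + proj n (-(t / dot a w) • w), ⟨h.add_proj_mem hx (W.smul_mem _ hw), ?_⟩, ?_⟩
  · change chr a _ = 0
    rw [map_add, chr_proj, map_smul, smul_eq_mul, neg_mul, div_mul_cancel₀ _ haw, ← ht,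
      ← AddCircle.coe_add, add_neg_cancel, AddCircle.coe_zero]
  · rw [dist_self_add_right]
    refine (norm_proj_le _).trans ?_
    rw [norm_smul, norm_neg, Real.norm_eq_abs, abs_div, div_mul_eq_mul_div]
    gcongr
    exact mul_le_of_le_one_left (norm_nonneg _) ht1

lemma SStar_subset_den (k : ℕ) : SStar (k + 1) n ⊆ den (SStarMult k n) := by
  intro d hd
  obtain ⟨hlt, Δ, W, hW, hk, rfl⟩ := mem_SStar_iff.1 hd
  obtain ⟨w, hw, hw0⟩ := W.exists_mem_ne_zero_of_ne_bot (ne_bot_of_finrank hk)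
  obtain ⟨j, hj⟩ := Function.ne_iff.1 hw0
  have hj' : w j ≠ 0 := hj
  let a : ℕ → Fin n → ℤ := fun m => Pi.single j ((m : ℤ) + 1)
  have hdot : ∀ m, dot (a m) w = ((m : ℝ) + 1) * w j := fun m => by
    rw [dot_single]; push_cast; rfl
  have hdot0 : ∀ m, dot (a m) w ≠ 0 := fun m => by
    rw [hdot]; exact mul_ne_zero (by positivity) hj'
  refine (mem_den_iff (properSubgroups k n)
    (fun Δ : AddSubgroup (Torus n) => D (Δ : Set (Torus n))) _).2 fun ε hε => ?_
  have hinf := infinite_of_near hW hk (Γ := fun m => Δ ⊓ (chr (a m)).ker) (C := ‖w‖ / |w j|)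
    (fun m => ⟨_, hW.inf_ker (a m), by have := finrank_slice ⟨w, hw, hdot0 m⟩; omega⟩)
    (fun m => inf_le_left) (fun m x hx => by
      obtain ⟨y, hy, hxy⟩ := exists_near_mem_ker hW hw (hdot0 m) hx
      refine ⟨y, hy, hxy.trans_eq ?_⟩
      rw [hdot, abs_mul, abs_of_pos (by positivity : (0 : ℝ) < m + 1), div_div, mul_comm])
    (lt_min hε (sub_pos.2 hlt))
  refine hinf.mono ?_
  rintro _ ⟨⟨m, rfl⟩, hm⟩
  obtain ⟨h1, h2⟩ := lt_min_iff.1 hm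
  refine ⟨mem_properSubgroups_iff.2 ⟨⟨_, hW.inf_ker (a m), ?_⟩, ?_⟩, h1⟩
  · have := finrank_slice ⟨w, hw, hdot0 m⟩; omega
  · linarith [(abs_lt.1 h2).2]

/-- Here `f` must vanish exactly, not only modulo 1. Subtracting multiples of `z`, invisible in the
torus, first reduces the value to at most `|f(z)|`; a move along `w₀` removes the rest. The bound is
small when `f(w₀)` is large compared with `f(z)`. -/
lemma exists_near_mem_slice {W : Submodule ℝ (Fin n → ℝ)} {f z : Fin n → ℤ} {w₀ : Fin n → ℝ}
    (hz : toReal z ∈ W) (hw₀ : w₀ ∈ W) (hfw : dot f w₀ ≠ 0) (hfz : dot f (toReal z) ≠ 0)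
    {x : Torus n} (hx : x ∈ torusOf W) :
    ∃ y ∈ torusOf (slice W f), dist x y ≤ |dot f (toReal z)| * ‖w₀‖ / |dot f w₀| := by
  obtain ⟨w, hw, rfl⟩ := hx
  set N := dot f (toReal z) with hN
  set r := Int.fract (dot f w / N) * N with hr
  have hrabs : |r| ≤ |N| := by
    rw [hr, abs_mul, abs_of_nonneg (Int.fract_nonneg _)]
    exact mul_le_of_le_one_left (abs_nonneg _) (Int.fract_lt_one _).le
  have hre : dot f w - ⌊dot f w / N⌋ * N = r := by
    rw [hr, Int.fract]; field_simp
  set w' := w - (⌊dot f w / N⌋ : ℝ) • toReal z - (r / dot f w₀) • w₀ with hw'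
  refine ⟨proj n w', ⟨w', ⟨?_, ?_⟩, rfl⟩, ?_⟩
  · exact W.sub_mem (W.sub_mem hw (W.smul_mem _ hz)) (W.smul_mem _ hw₀)
  · change dot f w' = 0
    rw [hw', map_sub, map_sub, map_smul, map_smul, smul_eq_mul, smul_eq_mul, ← hN, hre,
      div_mul_cancel₀ _ hfw, sub_self]
  · have : proj n w - proj n w' = proj n ((r / dot f w₀) • w₀) := by
      rw [hw', map_sub, map_sub, proj_eq_zero_iff.2 (smul_mem_intVectors (toReal_mem z) _)]
      abel
    rw [dist_eq_norm, this]
    refine (norm_proj_le _).trans ?_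
    rw [norm_smul, Real.norm_eq_abs, abs_div, div_mul_eq_mul_div]
    gcongr

lemma dot_self_toReal_pos {z : Fin n → ℤ} (hz : toReal z ≠ 0) : 0 < dot z (toReal z) := by
  obtain ⟨i, hi⟩ := Function.ne_iff.1 hz
  rw [dot_apply]
  exact Finset.sum_pos' (fun i _ => mul_self_nonneg _)
    ⟨i, Finset.mem_univ i, mul_self_pos.2 hi⟩

lemma IsRational.exists_int_ne_zero {W : Submodule ℝ (Fin n → ℝ)} (hW : IsRational W)
    (h0 : W ≠ ⊥) : ∃ z : Fin n → ℤ, toReal z ∈ W ∧ toReal z ≠ 0 := by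
  obtain ⟨w, hw, hw0⟩ := W.exists_mem_ne_zero_of_ne_bot h0
  obtain ⟨i, hi⟩ := Function.ne_iff.1 hw0
  obtain ⟨z, hz, hzi⟩ := hW.exists_int (LinearMap.proj i) ⟨w, hw, hi⟩
  exact ⟨z, hz, fun h => hzi (by rw [h]; rfl)⟩

lemma S_subset_den (k : ℕ) : S (k + 2) n ⊆ den (SMult (k + 1) n) := by
  intro d hd
  obtain ⟨hlt, W, hW, hk, rfl⟩ := mem_S_iff.1 hd
  obtain ⟨z, hz, hz0⟩ := hW.exists_int_ne_zero (ne_bot_of_finrank hk)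
  obtain ⟨a, haz, w₁, hw₁, haw₁⟩ := hW.exists_orthogonal (by omega) z
  have hzz := dot_self_toReal_pos hz0
  obtain ⟨w₀, hw₀, haw, hzw⟩ : ∃ w₀ ∈ W, dot a w₀ ≠ 0 ∧ dot z w₀ = 0 := by
    refine ⟨w₁ - (dot z w₁ / dot z (toReal z)) • toReal z,
      W.sub_mem hw₁ (W.smul_mem _ hz), ?_, ?_⟩
    · rwa [map_sub, map_smul, haz, smul_zero, sub_zero]
    · rw [map_sub, map_smul, smul_eq_mul, div_mul_cancel₀ _ hzz.ne', sub_self]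
  -- As `a(z) = 0` and `z · w₀ = 0`, the value at `z` stays fixed at `-z · z` while the value at
  -- `w₀` grows linearly.
  let f : ℕ → Fin n → ℤ := fun m => ((m : ℤ) + 1) • a - z
  have hdot : ∀ m w, dot (f m) w = ((m : ℝ) + 1) * dot a w - dot z w := fun m w => by
    rw [dot_sub]
    simp [dot_apply, Finset.mul_sum, mul_assoc]
  have hfw : ∀ m, dot (f m) w₀ = ((m : ℝ) + 1) * dot a w₀ := fun m => by
    rw [hdot, hzw, sub_zero]
  have hfz : ∀ m, dot (f m) (toReal z) = -dot z (toReal z) := fun m => by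
    rw [hdot, haz, mul_zero, zero_sub]
  have hfw0 : ∀ m, dot (f m) w₀ ≠ 0 := fun m => by
    rw [hfw]; exact mul_ne_zero (by positivity) haw
  have hrank : ∀ m, Module.finrank ℝ (slice W (f m)) = k + 1 := fun m => by
    have := finrank_slice ⟨w₀, hw₀, hfw0 m⟩; omega
  refine (mem_den_iff (properSubtori (k + 1) n)
    (fun Δ : AddSubgroup (Torus n) => D (Δ : Set (Torus n))) _).2 fun ε hε => ?_
  have hinf := infinite_of_near (isTangent_torusOf hW) hk (Γ := fun m => torusOf (slice W (f m)))
    (C := dot z (toReal z) * ‖w₀‖ / |dot a w₀|)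
    (fun m => ⟨_, isTangent_torusOf (hW.slice (f m)), hrank m⟩)
    (fun m => AddSubgroup.map_mono (Submodule.toAddSubgroup_mono inf_le_left)) (fun m x hx => by
      obtain ⟨y, hy, hxy⟩ := exists_near_mem_slice hz hw₀ (hfw0 m)
        (by rw [hfz]; exact neg_ne_zero.2 hzz.ne') hx
      refine ⟨y, hy, hxy.trans_eq ?_⟩
      rw [hfz, hfw, abs_neg, abs_of_pos hzz, abs_mul,
        abs_of_pos (by positivity : (0 : ℝ) < m + 1), div_div, mul_comm ((m : ℝ) + 1)])
    (lt_min hε (sub_pos.2 hlt))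
  refine hinf.mono ?_
  rintro _ ⟨⟨m, rfl⟩, hm⟩
  obtain ⟨h1, h2⟩ := lt_min_iff.1 hm
  refine ⟨mem_properSubtori_iff.2 ⟨⟨_, hW.slice (f m), hrank m, rfl⟩, ?_⟩, h1⟩
  linarith [(abs_lt.1 h2).2]

theorem den_SStarMult (k : ℕ) : den (SStarMult k n) = SStar (k + 1) n :=
  (den_SStarMult_subset k).antisymm (SStar_subset_den k)

theorem den_SMult {k : ℕ} (hk : 1 ≤ k) : den (SMult k n) = S (k + 1) n := by
  obtain ⟨k, rfl⟩ := Nat.exists_eq_add_of_le' hk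
  exact (den_SMult_subset _).antisymm (S_subset_den k)

lemma acc_S_subset {k : ℕ} (hk : 1 ≤ k) : acc (S k n) ⊆ S (k + 1) n := by
  rw [← den_SMult hk]
  exact acc_subset_den (properSubtori k n)
    (fun Δ : AddSubgroup (Torus n) => D (Δ : Set (Torus n)))

/-! ### Accumulation points of the one-dimensional spectrum -/

/-- The line spanned by an integer vector. -/
abbrev line (v : Fin n → ℤ) : Submodule ℝ (Fin n → ℝ) := Submodule.span ℝ {toReal v}

lemma isRational_line (v : Fin n → ℤ) : IsRational (line v) :=
  isRational_span (Set.singleton_subset_iff.2 (toReal_mem v))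

lemma mem_torusOf_line {v : Fin n → ℤ} {x : Torus n} :
    x ∈ torusOf (line v) ↔ ∃ t : ℝ, proj n (t • toReal v) = x := by
  constructor
  · rintro ⟨w, hw, rfl⟩
    obtain ⟨t, rfl⟩ := Submodule.mem_span_singleton.1 hw
    exact ⟨t, rfl⟩
  · rintro ⟨t, rfl⟩
    exact ⟨_, Submodule.mem_span_singleton.2 ⟨t, rfl⟩, rfl⟩

/-- The times at which a line comes closest to the center are rational, with denominators bounded
in terms of the line. -/
lemma exists_int_of_dist_eq {v : Fin n → ℤ} (hv : ∀ i, v i ≠ 0) (hn : 0 < n) {t : ℝ}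
    (ht : dist (center n) (proj n (t • toReal v)) = D (torusOf (line v) : Set (Torus n))) :
    ∃ m : ℤ, t * ((2 * ∑ i, (v i).natAbs).factorial : ℕ) = m := by
  have hT := isTangent_torusOf (isRational_line v)
  have hmem : proj n (t • toReal v) ∈ torusOf (line v) := mem_torusOf_line.2 ⟨t, rfl⟩
  have hle : ∀ i, (v i).natAbs ≤ ∑ i, (v i).natAbs := fun i =>
    Finset.single_le_sum (f := fun i => (v i).natAbs) (fun _ _ => Nat.zero_le _)
      (Finset.mem_univ i)
  have hline : line v ≠ ⊥ := by
    rw [Ne, Submodule.span_singleton_eq_bot]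
    intro h0
    have := congrFun h0 ⟨0, hn⟩
    exact hv ⟨0, hn⟩ (by simpa [toReal] using this)
  obtain ⟨a, L, hL, hL0, hLK, hchr⟩ : ∃ (a : Fin n → ℤ) (L : ℤ), dot a (toReal v) = L ∧ L ≠ 0 ∧
      L.natAbs ≤ 2 * ∑ i, (v i).natAbs ∧ chr a (proj n (t • toReal v)) = 0 := by
    rcases (D_nonneg (torusOf (line v) : Set (Torus n))).eq_or_lt with h0 | hpos
    · rw [← h0, dist_eq_zero] at ht
      refine ⟨Pi.single ⟨0, hn⟩ 2, 2 * v ⟨0, hn⟩, ?_, ?_, ?_, ?_⟩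
      · rw [dot_single]; simp [toReal]
      · exact mul_ne_zero two_ne_zero (hv _)
      · have := hle ⟨0, hn⟩
        rw [Int.natAbs_mul]
        simpa using this
      · rw [← ht, chr_single, center_apply, ← AddCircle.coe_zsmul, AddCircle.coe_eq_zero_iff]
        exact ⟨1, by norm_num⟩
    · obtain ⟨y, hxy, hy⟩ := exists_lift (proj n (t • toReal v))
      have hyn := norm_lift hy
      rw [ht] at hyn
      rw [hxy] at hmem
      obtain ⟨i₀, hi₀⟩ : ∃ i, |y i| = D (torusOf (line v) : Set (Torus n)) := by
        by_contra! hcon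
        have : ‖y‖ < D (torusOf (line v) : Set (Torus n)) :=
          (pi_norm_lt_iff hpos).2 fun i =>
            lt_of_le_of_ne ((norm_le_pi_norm y i).trans hyn.le) (hcon i)
        exact this.ne hyn
      obtain ⟨i, j, s, r, -, hs, hr, ⟨w, hw, hne⟩, hchr⟩ := exists_pairVec hline hpos hyn
        (fun w hw => hT.D_le_norm hmem hw) (fun w hw h0 => by
          -- On a line with all `v i` nonzero, every minimizer is extreme: one active coordinate
          -- already forces `c = 0`.
          obtain ⟨c, rfl⟩ := Submodule.mem_span_singleton.1 hw
          have h1 := h0 i₀ hi₀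
          have h2 : c = 0 := by simpa [toReal, hv i₀] using h1
          rw [h2, zero_smul])
      rw [← hxy] at hchr
      refine ⟨_, s * v i - r * v j, ?_, ?_, ?_, hchr⟩
      · rw [dot_pairVec]; simp [toReal]
      · intro h0
        obtain ⟨c, rfl⟩ := Submodule.mem_span_singleton.1 hw
        apply hne
        rw [map_smul, dot_pairVec]
        have : (s : ℝ) * toReal v i - r * toReal v j = 0 := by
          simp only [toReal]; exact_mod_cast h0
        rw [this, smul_zero]
      · have h1 := hle i
        have h2 := hle j
        rcases hs with rfl | rfl <;> rcases hr with rfl | rfl <;> omega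
  rw [chr_proj, map_smul, hL, smul_eq_mul, AddCircle.coe_eq_zero_iff] at hchr
  obtain ⟨m, hm⟩ := hchr
  -- The product `t L` is an integer, and the factorial is a common multiple of all the possible
  -- values of `L`.
  have hdvd : L ∣ (((2 * ∑ i, (v i).natAbs).factorial : ℕ) : ℤ) :=
    Int.natAbs_dvd.1 (Int.natCast_dvd_natCast.2
      (Nat.dvd_factorial (Int.natAbs_pos.2 hL0) hLK))
  obtain ⟨q, hq⟩ := hdvd
  refine ⟨m * q, ?_⟩
  have hq' : (((2 * ∑ i, (v i).natAbs).factorial : ℕ) : ℝ) = L * q := by exact_mod_cast hq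
  rw [hq', ← mul_assoc, ← hm]
  simp

lemma D_line_cons_le {v : Fin n → ℤ} {M : ℕ} (hM : 0 < M) :
    D (torusOf (line (Fin.cons (M : ℤ) v : Fin (n + 1) → ℤ)) : Set (Torus (n + 1)))
      ≤ D (torusOf (line v) : Set (Torus n)) + ‖toReal v‖ / M := by
  obtain ⟨_, hx, hxd⟩ := (isTangent_torusOf (isRational_line v)).exists_dist_eq
  obtain ⟨t, rfl⟩ := mem_torusOf_line.1 hx
  have hM' : (0 : ℝ) < M := by exact_mod_cast hM
  -- The time near the optimal `t` at which the new coordinate `M s` is exactly 1/2 modulo 1.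
  set s : ℝ := (⌊t * M⌋ + 1 / 2) / M with hs
  have hst : |t - s| ≤ 1 / M := by
    have e : t - s = (Int.fract (t * M) - 1 / 2) / M := by
      rw [hs, Int.fract]; field_simp; ring
    rw [e, abs_div, abs_of_pos hM']
    gcongr
    have h1 := Int.fract_nonneg (t * M)
    have h2 := Int.fract_lt_one (t * M)
    rw [abs_le]; constructor <;> linarith
  refine (D_le_dist (mem_torusOf_line.2 ⟨s, rfl⟩)).trans
    ((dist_pi_le_iff (add_nonneg (D_nonneg _) (by positivity))).2 fun l => ?_)
  refine Fin.cases ?_ (fun l => ?_) l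
  · have : proj (n + 1) (s • toReal (Fin.cons (M : ℤ) v : Fin (n + 1) → ℤ)) 0
        = center (n + 1) 0 := by
      rw [proj_apply, center_apply, ← sub_eq_zero, ← AddCircle.coe_sub,
        AddCircle.coe_eq_zero_iff]
      refine ⟨⌊t * M⌋, ?_⟩
      simp only [Pi.smul_apply, toReal, Fin.cons_zero, smul_eq_mul, hs]
      push_cast
      field_simp
      simp
    rw [this, dist_self]
    exact add_nonneg (D_nonneg _) (by positivity)
  · have h1 := dist_le_pi_dist (center n) (proj n (t • toReal v)) l
    rw [hxd] at h1
    have h2 : dist (proj n (t • toReal v) l)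
        (proj (n + 1) (s • toReal (Fin.cons (M : ℤ) v : Fin (n + 1) → ℤ)) l.succ)
        ≤ ‖toReal v‖ / M := by
      rw [proj_apply, proj_apply, dist_eq_norm, ← AddCircle.coe_sub]
      refine (norm_coe_le_abs _).trans ?_
      have : (t • toReal v) l - (s • toReal (Fin.cons (M : ℤ) v : Fin (n + 1) → ℤ)) l.succ
          = (t - s) * toReal v l := by
        simp [toReal]; ring
      rw [this, abs_mul, div_eq_inv_mul, ← one_div]
      gcongr
      exact norm_le_pi_norm (toReal v) l
    exact (dist_triangle _ (proj n (t • toReal v) l) _).trans (add_le_add h1 h2)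

lemma S_one_subset_acc (m : ℕ) : S 1 m ⊆ acc (S 1 (m + 1)) := by
  intro d hd
  obtain ⟨hlt, W, hW, hk, rfl⟩ := mem_S_iff.1 hd
  have hm : 0 < m := by
    have := Submodule.finrank_le W
    rw [hk, Module.finrank_fin_fun] at this
    omega
  obtain ⟨v, hvW, hv0⟩ := hW.exists_int_ne_zero (ne_bot_of_finrank hk)
  obtain rfl : line v = W := by
    refine Submodule.eq_of_le_of_finrank_eq
      ((Submodule.span_singleton_le_iff_mem _ _).2 hvW) ?_
    rw [hk, finrank_span_singleton hv0]
  have hv : ∀ i, v i ≠ 0 := by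
    obtain ⟨_, hx, hxd⟩ := (isTangent_torusOf hW).exists_dist_eq
    obtain ⟨t, rfl⟩ := mem_torusOf_line.1 hx
    rw [← hxd, dist_center_lt_iff] at hlt
    intro i hi
    exact hlt i (by simp [toReal, hi])
  set K := (2 * ∑ i, (v i).natAbs).factorial with hK
  have hKpos : 0 < K := Nat.factorial_pos _
  let u : ℕ → Fin (m + 1) → ℤ := fun p => Fin.cons (((p + 1) * K : ℕ) : ℤ) v
  have hupper : ∀ p : ℕ, D (torusOf (line (u p)) : Set (Torus (m + 1)))
      ≤ D (torusOf (line v) : Set (Torus m)) + ‖toReal v‖ / (p + 1) := fun p => by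
    refine (D_line_cons_le (v := v) (Nat.mul_pos (Nat.succ_pos p) hKpos)).trans ?_
    gcongr
    have : 1 ≤ (K : ℝ) := by exact_mod_cast hKpos
    push_cast
    nlinarith [(by positivity : (0 : ℝ) ≤ p + 1)]
  have hstrict : ∀ p : ℕ, D (torusOf (line v) : Set (Torus m))
      < D (torusOf (line (u p)) : Set (Torus (m + 1))) := fun p => by
    obtain ⟨_, hx, hxd⟩ := (isTangent_torusOf (isRational_line (u p))).exists_dist_eq
    obtain ⟨t, rfl⟩ := mem_torusOf_line.1 hx
    have hsub : dist (center m) (proj m (t • toReal v))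
        ≤ dist (center (m + 1)) (proj (m + 1) (t • toReal (u p))) :=
      (dist_pi_le_iff dist_nonneg).2 fun l =>
        dist_le_pi_dist (center (m + 1)) (proj (m + 1) (t • toReal (u p))) l.succ
    have hge := D_le_dist (mem_torusOf_line.2 ⟨t, rfl⟩ : proj m (t • toReal v) ∈ torusOf (line v))
    -- Equality would make `t` optimal for the old line too, so `t K` would be an integer. The new
    -- coordinate `(p + 1) K t` would then vanish, which is impossible at distance less than 1/2
    -- from the center.
    refine lt_of_le_of_ne (by linarith) fun heq => ?_
    obtain ⟨q, hq⟩ := exists_int_of_dist_eq hv hm (t := t) (by linarith)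
    rw [← heq] at hxd
    rw [← hxd, dist_center_lt_iff] at hlt
    apply hlt 0
    rw [proj_apply, AddCircle.coe_eq_zero_iff]
    refine ⟨(p + 1) * q, ?_⟩
    simp only [Pi.smul_apply, toReal, u, Fin.cons_zero, smul_eq_mul, zsmul_eq_mul, mul_one]
    push_cast
    rw [← hq, ← hK]
    ring
  change AccPt _ (𝓟 _)
  rw [accPt_iff_nhds]
  intro B hB
  obtain ⟨ε, hε, hb⟩ := Metric.mem_nhds_iff.1 hB
  have hC : Tendsto (fun p : ℕ => ‖toReal v‖ / ((p : ℝ) + 1)) atTop (𝓝 0) := by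
    simpa [div_eq_mul_inv] using
      (tendsto_one_div_add_atTop_nhds_zero_nat (𝕜 := ℝ)).const_mul ‖toReal v‖
  obtain ⟨p, hp⟩ := (hC.eventually_lt_const (lt_min hε (sub_pos.2 hlt))).exists
  obtain ⟨hp1, hp2⟩ := lt_min_iff.1 hp
  have h1 := hupper p
  have h2 := hstrict p
  refine ⟨_, ⟨hb ?_, mem_S_iff.2 ⟨?_, line (u p), isRational_line _, ?_, rfl⟩⟩, h2.ne'⟩
  · rw [Metric.mem_ball, Real.dist_eq, abs_of_pos (sub_pos.2 h2)]
    linarith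
  · linarith
  · refine finrank_span_singleton fun h0 => hv ⟨0, hm⟩ ?_
    have h3 : ((v ⟨0, hm⟩ : ℤ) : ℝ) = 0 := congrFun h0 (Fin.succ ⟨0, hm⟩)
    exact_mod_cast h3

end LonelyRunner

end

theorem theorem1p4 (n k k' : ℕ) (hn : 2 ≤ n) (hk : 1 ≤ k) (hkn : k < n) (hk'n : k' < n) :
    (LonelyRunner.HasOnlyUpperAcc (LonelyRunner.S k n) ∧
      LonelyRunner.HasOnlyUpperAcc (LonelyRunner.SStar k' n)) ∧
    (LonelyRunner.acc (LonelyRunner.S k n) ⊆ LonelyRunner.S (k + 1) n ∧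
      LonelyRunner.S (k + 1) n ⊆ LonelyRunner.SStar (k + 1) n ∧
      LonelyRunner.SStar (k + 1) n = LonelyRunner.SStar 0 (n - k - 1)) ∧
    LonelyRunner.den (LonelyRunner.SMult k n) = LonelyRunner.S (k + 1) n ∧
    (LonelyRunner.den (LonelyRunner.SStarMult k' n) = LonelyRunner.SStar (k' + 1) n ∧
      LonelyRunner.SStar (k' + 1) n = LonelyRunner.SStar k' (n - 1)) ∧
    (LonelyRunner.S 1 (n - 1) ⊆ LonelyRunner.acc (LonelyRunner.S 1 n) ∧
      LonelyRunner.acc (LonelyRunner.S 1 n) ⊆ LonelyRunner.S 2 n ∧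
      LonelyRunner.S 2 n ⊆ LonelyRunner.SStar 2 n ∧
      LonelyRunner.SStar 2 n = LonelyRunner.SStar 1 (n - 1)) := by
  obtain ⟨m, rfl⟩ : ∃ m, n = m + 1 := ⟨n - 1, by omega⟩
  -- Both spectra are by definition images of a set of subgroups under `D`.
  refine ⟨⟨LonelyRunner.hasOnlyUpperAcc_D _, LonelyRunner.hasOnlyUpperAcc_D _⟩,
    ⟨LonelyRunner.acc_S_subset hk, LonelyRunner.S_subset_SStar _, ?_⟩, LonelyRunner.den_SMult hk,
    ⟨LonelyRunner.den_SStarMult k', LonelyRunner.SStar_succ_succ k' m⟩,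
    LonelyRunner.S_one_subset_acc m, LonelyRunner.acc_S_subset le_rfl, LonelyRunner.S_subset_SStar _,
    LonelyRunner.SStar_succ_succ 1 m⟩
  obtain ⟨q, rfl⟩ : ∃ q, m = q + k := ⟨m - k, by omega⟩
  have : q + k + 1 - k - 1 = q := by omega
  rw [this]
  exact LonelyRunner.SStar_add (k + 1) q
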